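/- **Proposition (very short returns).** Let $M$ be a compact connected Riemannian manifold without boundary with its Riemannian distance $d$, let $T:M\to M$ be a $C^2$-diffeomorphism, and put $$A=\|DT\|_{\infty}+\|DT^{-1}\|_{\infty},\qquad \mathfrak a=(4\log A)^{-1},$$ where $\|\cdot\|_\infty$ is the supremum over $M$ of the operator norm. For $\rho>0$ let $$\mathcal V_\rho=\{\mathsf x\in M:\ B_\rho(\mathsf x)\cap T^nB_\rho(\mathsf x)\neq\varnothing\ \text{ for some } 1\le n<\mathfrak a|\log\rho|\}.$$ *Young tower.* Suppose that $(M,T)$ is modelled by a Young tower: there is a measurable base $\Lambda\subset M$ which is partitioned by local unstable leaves $\gamma^u(x)$ and also by local stable leaves $\gamma^s(x)$, such that $\gamma^u(x)\cap\gamma^s(y)$ is a single point, lying in $\Lambda$, for all $x,y\in\Lambda$; there are finite reference measures $\hat m_{\gamma^u}$ on the sets $\gamma^u\cap\Lambda$, depending measurably on the leaf; and there are countably many disjoint non-empty measurable sets $\Lambda_i\subset\Lambda$ with return times $R_i\ge1$ such that * $\hat m_{\gamma^u}(\Lambda\setminus\bigcup_i\Lambda_i)=0$ for every $\gamma^u$,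 and $\gamma^s(x)\cap\Lambda\subset\Lambda_i$ for $x\in\Lambda_i$; * (Markov property) for $x\in\Lambda_i$, $T^{R_i}(\gamma^u(x)\cap\Lambda_i)=\gamma^u(T^{R_i}x)\cap\Lambda$ and $T^{R_i}(\gamma^s(x)\cap\Lambda)\subset\gamma^s(T^{R_i}x)\cap\Lambda$; * the $R_i$ have greatest common divisor $1$, $\{i:R_i=n\}$ is finite for each $n$, and the function $R$, with $R|_{\Lambda_i}=R_i$, is $\hat m_{\gamma^u}$-integrable for every $\gamma^u$. Let $\hat T=T^{R_i}$ on $\Lambda_i$. The separation time $s(x,y)\in\mathbb N_0\cup\{\infty\}$ is the smallest $k\ge0$ for which $\hat T^kx$ and $\hat T^ky$ do not lie in a common $\Lambda_i$. Let $J\hat T>0$ be (a version of) the Jacobian of $\hat T$ along unstable leaves with respect to the measures $\hat m_{\gamma^u}$, i.e. $\hat m_{\gamma^u(T^{R_i}x)}(\hat TF)=\int_FJ\hat T\,d\hat m_{\gamma^u(x)}$ for measurable $F\subset\gamma^u(x)\cap\Lambda_i$, $x\in\Lambda_i$. Let $m$ be a generalised SRB measure for $\hat T$: a $\hat T$-invariant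 measure carried by $\Lambda$ with a disintegration $dm=dm_{\gamma^u}\,d\nu(\gamma^u)$ into probability measures $m_{\gamma^u}$ on $\gamma^u\cap\Lambda$ with $m_{\gamma^u}\ll\hat m_{\gamma^u}$ for almost every $\gamma^u$. It is normalised so that $$\mu(S)=\sum_i\sum_{j=0}^{R_i-1}m(T^{-j}S\cap\Lambda_i)$$ is a probability measure on $M$. *Assumptions.* * (B1) There are $C_0>0$ and $\alpha\in(0,1)$ such that for all $x,y\in\Lambda$ (with the convention $\alpha^\infty=0$): * (a) $\bigl|\log\frac{J\hat Tx}{J\hat Ty}\bigr|\le C_0\alpha^{s(\hat Tx,\hat Ty)}$ if $\gamma^u(x)=\gamma^u(y)$ and $s(x,y)\ge1$; * (b) $d(\hat T^kx,\hat T^ky)\le C_0\alpha^{s(x,y)-k}$ for $0\le k<s(x,y)$ if $\gamma^u(x)=\gamma^u(y)$ and $s(x,y)\ge 1$; * (c) $\prod_{k\ge n}\frac{J\hat T(\hat T^kx)}{J\hat T(\hat T^ky)}$ converges to a positive number and $\log\prod_{k\ge n}\frac{J\hat T(\hat T^kx)}{J\hat T(\hat T^ky)}\le C_0\alpha^n$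 for all $n\ge 0$, if $\gamma^s(x)=\gamma^s(y)$ and $s(x,y)=\infty$; * (d) for any two unstable leaves $\gamma,\gamma'$ the holonomy $\Theta:\gamma\cap\Lambda\to\gamma'\cap\Lambda$, $\Theta(z)\in\gamma'\cap\gamma^s(z)$, satisfies $\hat m_{\gamma'}(\Theta F)=\int_FD\,d\hat m_\gamma$ for measurable $F\subset\gamma\cap\Lambda$, with a measurable function $D$ such that $D(z)=\prod_{k\ge0}\frac{J\hat T(\hat T^kz)}{J\hat T(\hat T^k\Theta z)}$ whenever $s(z,\Theta z)=\infty$; * (e) $d(\hat T^nx,\hat T^ny)\le C_0\alpha^n$ for all integers $0\le n\le s(x,y)$ if $\gamma^s(x)=\gamma^s(y)$ and $s(x,y)\ge1$. * (B2) There are $C_1>0$ and $\lambda>9$ with $\hat m_{\gamma^u}(R>k)\le C_1k^{-\lambda}$ for all $k\ge1$ and all unstable leaves $\gamma^u$. * (B3) There are $\varsigma'>0$, $C_2>0$ and, for all small $\rho>0$, sets $\mathcal E_\rho\subset M$ with $\mu(\mathcal E_\rho)\le C_2|\log\rho|^{-\lambda/2}$, such that for almost every unstable leaf $\gamma^u$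 one has $m_{\gamma^u}(B_\rho(\mathsf x))\le C_2\,\rho^{\varsigma'}$ for all small $\rho$ (with a bound on $\rho$ that does not depend on the leaf) and all $\mathsf x\notin\mathcal E_\rho$. Then there is a constant $C_{10}>0$ such that for all sufficiently small $\rho>0$ $$\mu(\mathcal V_\rho)\le\frac{C_{10}}{|\log\rho|^{\frac{\lambda-9}4}}.$$ -/

import Mathlib

open Set Filter Topology MeasureTheory ProbabilityTheory Bundle
open scoped ENNReal Manifold ContDiff

noncomputable section

/-- `IsInfProd a n P`: the infinite product `∏_{k ≥ n} a k` of real numbers converges, in the usual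
sense for products with positive factors, to the positive number `P`. -/
def IsInfProd (a : ℕ → ℝ) (n : ℕ) (P : ℝ) : Prop :=
  0 < P ∧ Tendsto (fun N => ∏ k ∈ Finset.Ico n N, a k) atTop (𝓝 P)

/-- `α ^ s` for an extended natural number `s`, with `α ^ ∞ = 0` (used for `α ∈ (0, 1)`). -/
def powENat (α : ℝ) (s : ℕ∞) : ℝ := if s = ⊤ then 0 else α ^ s.toNat

/-- The return time function determined by a countable partition `base i` with return times `R i`:
it equals `R i` on `base i`, and is given the value `0` off the union of the pieces. -/
def returnTime {M ι : Type*} (base : ι → Set M) (R : ι → ℕ) (x : M) : ℕ :=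
  open Classical in if h : ∃ i, x ∈ base i then R h.choose else 0

/-- A Young tower for `T : M → M`: a base `Λ` with a product structure given by local unstable
leaves `unstable x` and local stable leaves `stable x`, a countable partition `Λ_i = base i` of `Λ`
modulo null sets with return times `R i` satisfying the Markov property, and a reference measure,
given through the measures `mhat x` that it induces on the unstable leaves `unstable x`. -/
structure YoungTower {M : Type*} [MeasurableSpace M] (T : M → M) (ι : Type*) where
  /-- The base of the tower. -/
  Λ : Set M
  measurableSet_Λ : MeasurableSet Λ
  /-- The local unstable leaf through a point of `Λ`. -/
  unstable : M → Set M
  /-- The local stable leaf through a point of `Λ`. -/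
  stable : M → Set M
  measurableSet_unstable : ∀ x ∈ Λ, MeasurableSet (unstable x)
  measurableSet_stable : ∀ x ∈ Λ, MeasurableSet (stable x)
  mem_unstable : ∀ x ∈ Λ, x ∈ unstable x
  mem_stable : ∀ x ∈ Λ, x ∈ stable x
  unstable_eq : ∀ x ∈ Λ, ∀ y ∈ Λ, y ∈ unstable x → unstable y = unstable x
  stable_eq : ∀ x ∈ Λ, ∀ y ∈ Λ, y ∈ stable x → stable y = stable x
  /-- Product structure: every unstable leaf meets every stable leaf in exactly one point, and this
  point lies in `Λ`. -/
  product : ∀ x ∈ Λ, ∀ y ∈ Λ, ∃ z ∈ Λ, unstable x ∩ stable y = {z}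
  /-- The pieces `Λ_i` of the base. -/
  base : ι → Set M
  measurableSet_base : ∀ i, MeasurableSet (base i)
  base_nonempty : ∀ i, (base i).Nonempty
  base_subset : ∀ i, base i ⊆ Λ
  base_disjoint : Pairwise fun i j => Disjoint (base i) (base j)
  /-- Each `Λ_i` consists of full stable leaves of `Λ`; in particular it is a rectangle: with `x`
  and `y` it contains the point of `unstable x ∩ stable y`. -/
  stable_subset_base : ∀ i, ∀ x ∈ base i, stable x ∩ Λ ⊆ base i
  /-- The return times. -/
  R : ι → ℕ
  R_pos : ∀ i, 1 ≤ R i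
  /-- Markov property: the return map takes the unstable leaves of `Λ_i` *onto* full unstable
  leaves of `Λ`. -/
  markov_unstable : ∀ i, ∀ x ∈ base i,
    T^[R i] '' (unstable x ∩ base i) = unstable (T^[R i] x) ∩ Λ
  /-- Markov property: the return map takes stable leaves *into* stable leaves. -/
  markov_stable : ∀ i, ∀ x ∈ base i,
    T^[R i] '' (stable x ∩ Λ) ⊆ stable (T^[R i] x) ∩ Λ
  /-- The greatest common divisor of the return times is one. -/
  gcd_R : ∀ d : ℕ, (∀ i, d ∣ R i) → d = 1
  /-- There are only finitely many beams of a given height. -/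
  finite_beams : ∀ n, {i | R i = n}.Finite
  /-- `mhat x` is the reference measure on (the trace on `Λ` of) the unstable leaf through `x`. -/
  mhat : Kernel M M
  mhat_finite : ∀ x ∈ Λ, IsFiniteMeasure (mhat x)
  mhat_leaf : ∀ x ∈ Λ, mhat x (unstable x ∩ Λ)ᶜ = 0
  mhat_eq : ∀ x ∈ Λ, ∀ y ∈ Λ, unstable x = unstable y → mhat x = mhat y
  /-- `Λ` is the union of the `Λ_i` up to a null set of the reference measure. -/
  mhat_cover : ∀ x ∈ Λ, mhat x (Λ \ ⋃ i, base i) = 0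
  /-- The return time function is integrable on the unstable leaves. -/
  integrable_R : ∀ x ∈ Λ, ∫⁻ y, (returnTime base R y : ℝ≥0∞) ∂(mhat x) < ⊤

namespace YoungTower

variable {M : Type*} [MeasurableSpace M] {T : M → M} {ι : Type*}

/-- The return time function, equal to `R i` on `Λ_i`. -/
def ret (Y : YoungTower T ι) : M → ℕ := returnTime Y.base Y.R

/-- The return map `x ↦ T ^ (R i) x` for `x ∈ Λ_i` (the identity off the union of the `Λ_i`). -/
def That (Y : YoungTower T ι) (x : M) : M := T^[Y.ret x] x

/-- The separation time: the smallest `k ≥ 0` for which the `k`-th images of `x` and `y` under the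
return map do not lie in a common `Λ_i`. -/
def sepTime (Y : YoungTower T ι) (x y : M) : ℕ∞ :=
  ⨅ (k : ℕ) (_ : ¬ ∃ i, Y.That^[k] x ∈ Y.base i ∧ Y.That^[k] y ∈ Y.base i), (k : ℕ∞)

/-- `J` is (a version of) the Jacobian of the return map along unstable leaves with respect to the
reference measure, i.e. of the Radon-Nikodym derivative on `unstable x ∩ Λ_i` of the pull-back
under `T ^ (R i)` of the reference measure on the image leaf. -/
structure IsJacobian (Y : YoungTower T ι) (J : M → ℝ) : Prop where
  measurable : Measurable J
  pos : ∀ i, ∀ x ∈ Y.base i, 0 < J x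
  image : ∀ i, ∀ x ∈ Y.base i, ∀ F ⊆ Y.unstable x ∩ Y.base i, MeasurableSet F →
    Y.mhat (T^[Y.R i] x) (T^[Y.R i] '' F) = ∫⁻ y in F, ENNReal.ofReal (J y) ∂(Y.mhat x)

/-- The holonomy along stable leaves into the unstable leaf through `x'`: the point `y` is sent to
the point of `unstable x' ∩ stable y`. -/
def holonomy (Y : YoungTower T ι) (x' y : M) : M :=
  open Classical in
  if h : (Y.unstable x' ∩ Y.stable y).Nonempty then h.some else y

/-- The measure on `M` obtained by spreading a measure `m` on the base up the tower:
`μ(S) = ∑_i ∑_{j < R_i} m(T^{-j} S ∩ Λ_i)`. -/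
def towerMeasure (Y : YoungTower T ι) (m : Measure M) : Measure M :=
  Measure.sum fun i => ∑ j ∈ Finset.range (Y.R i), (m.restrict (Y.base i)).map T^[j]

/-- `m` is a generalised SRB measure for the return map, with conditional measures `κ x` on the
unstable leaves `unstable x`: it is carried by the base, invariant under the return map, and its
conditional measures on unstable leaves are absolutely continuous with respect to the reference
measures. The disintegration `dm = dm_γ dν(γ)`, with `ν` the image of `m` on the space of unstable
leaves, is expressed as an integral over `x`, with `m_γ = κ x` for every `x` on the leaf `γ`. -/
structure IsSRB (Y : YoungTower T ι) (m : Measure M) (κ : Kernel M M) : Prop where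
  carried : m Y.Λᶜ = 0
  invariant : ∀ S, MeasurableSet S → m (Y.That ⁻¹' S) = m S
  prob : ∀ x ∈ Y.Λ, IsProbabilityMeasure (κ x)
  leaf : ∀ x ∈ Y.Λ, κ x (Y.unstable x ∩ Y.Λ)ᶜ = 0
  leaf_eq : ∀ x ∈ Y.Λ, ∀ y ∈ Y.Λ, Y.unstable x = Y.unstable y → κ x = κ y
  disintegration : ∀ S, MeasurableSet S → m S = ∫⁻ x, κ x S ∂m
  absolutelyContinuous : ∀ᵐ x ∂m, κ x ≪ Y.mhat x

/-- Polynomial decay of the tail: `m̂_γ(R > k) ≤ C₁ k^{-lam}` for all unstable leaves `γ`. -/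
def PolynomialTail (Y : YoungTower T ι) (lam : ℝ) : Prop :=
  ∃ C₁ : ℝ, 0 < C₁ ∧ ∀ x ∈ Y.Λ, ∀ k : ℕ, 1 ≤ k →
    Y.mhat x {y | k < Y.ret y} ≤ ENNReal.ofReal (C₁ * (k : ℝ) ^ (-lam))

end YoungTower

/-- Regularity of the Jacobian and of the metric on the leaves. -/
def YoungTower.Regular {M : Type*} [MetricSpace M] [MeasurableSpace M] {T : M → M} {ι : Type*}
    (Y : YoungTower T ι) : Prop :=
  ∃ C₀ : ℝ, 0 < C₀ ∧ ∃ α ∈ Ioo (0 : ℝ) 1, ∃ J : M → ℝ, Y.IsJacobian J ∧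
    -- (a) distortion of the Jacobian on unstable leaves
    (∀ x ∈ Y.Λ, ∀ y ∈ Y.Λ, 1 ≤ Y.sepTime x y → Y.unstable x = Y.unstable y →
      |Real.log (J x / J y)| ≤ C₀ * powENat α (Y.sepTime (Y.That x) (Y.That y))) ∧
    -- (b) backward contraction on unstable leaves
    (∀ x ∈ Y.Λ, ∀ y ∈ Y.Λ, 1 ≤ Y.sepTime x y → Y.unstable x = Y.unstable y →
      ∀ k : ℕ, (k : ℕ∞) < Y.sepTime x y →
        dist (Y.That^[k] x) (Y.That^[k] y) ≤ C₀ * powENat α (Y.sepTime x y - k)) ∧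
    -- (c) the Jacobians along orbits on a common stable leaf
    (∀ x ∈ Y.Λ, ∀ y ∈ Y.Λ, Y.stable x = Y.stable y → Y.sepTime x y = ⊤ →
      ∀ n : ℕ, ∃ P : ℝ, IsInfProd (fun k => J (Y.That^[k] x) / J (Y.That^[k] y)) n P ∧
        Real.log P ≤ C₀ * α ^ n) ∧
    -- (d) absolute continuity of the holonomy `Θ` from the leaf of `x` to the leaf of `x'`
    (∀ x ∈ Y.Λ, ∀ x' ∈ Y.Λ, ∃ D : M → ℝ, Measurable D ∧
      (∀ y ∈ Y.unstable x ∩ Y.Λ, Y.sepTime y (Y.holonomy x' y) = ⊤ →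
        IsInfProd (fun k => J (Y.That^[k] y) / J (Y.That^[k] (Y.holonomy x' y))) 0 (D y)) ∧
      ∀ F ⊆ Y.unstable x ∩ Y.Λ, MeasurableSet F →
        Y.mhat x' (Y.holonomy x' '' F) = ∫⁻ y in F, ENNReal.ofReal (D y) ∂(Y.mhat x)) ∧
    -- (e) contraction on stable leaves
    (∀ x ∈ Y.Λ, ∀ y ∈ Y.Λ, 1 ≤ Y.sepTime x y → Y.stable x = Y.stable y →
      ∀ n : ℕ, (n : ℕ∞) ≤ Y.sepTime x y →
        dist (Y.That^[n] x) (Y.That^[n] y) ≤ C₀ * α ^ n)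

/-- Geometric regularity: for some exponent `ς' > 0`, the conditional measures `κ x` on unstable
leaves give balls of small radius `ρ` mass at most `C₂ ρ^{ς'}`, provided that their centres avoid a
set `Ex ρ` with `μ (Ex ρ) ≤ C₂ |log ρ|^{-lam / 2}`. -/
def GeometricallyRegular {M : Type*} [MetricSpace M] [MeasurableSpace M]
    (m : Measure M) (κ : Kernel M M) (μ : Measure M) (lam : ℝ) : Prop :=
  ∃ ς' : ℝ, 0 < ς' ∧ ∃ C₂ : ℝ, 0 < C₂ ∧ ∃ ρ₁ ∈ Ioo (0 : ℝ) 1, ∃ Ex : ℝ → Set M,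
    (∀ ρ ∈ Ioo 0 ρ₁, μ (Ex ρ) ≤ ENNReal.ofReal (C₂ * |Real.log ρ| ^ (-lam / 2))) ∧
    ∀ᵐ x ∂m, ∀ ρ ∈ Ioo 0 ρ₁, ∀ c, c ∉ Ex ρ →
      κ x (Metric.ball c ρ) ≤ ENNReal.ofReal (C₂ * ρ ^ ς')

/-- The set of centres of balls of radius `ρ` with very short returns:
`B_ρ(c) ∩ T^n B_ρ(c) ≠ ∅` for some `1 ≤ n < a |log ρ|`. -/
def veryShortReturns {M : Type*} [MetricSpace M] (T : M → M) (a ρ : ℝ) : Set M :=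
  {c | ∃ n : ℕ, 1 ≤ n ∧ (n : ℝ) < a * |Real.log ρ| ∧
    (Metric.ball c ρ ∩ T^[n] '' Metric.ball c ρ).Nonempty}

/-- The supremum over `M` of the operator norms (with respect to the Riemannian metric) of the
derivative of a map `M → M`. -/
def supNormDeriv (E : Type*) [NormedAddCommGroup E] [NormedSpace ℝ E]
    {M : Type*} [TopologicalSpace M] [ChartedSpace E M]
    [RiemannianBundle (fun x : M => TangentSpace 𝓘(ℝ, E) x)] (f : M → M) : ℝ :=
  ⨆ x : M, ‖mfderiv 𝓘(ℝ, E) 𝓘(ℝ, E) f x‖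

/-- The constant `𝔞 = (4 log A)⁻¹` with `A = ‖DT‖_∞ + ‖DT⁻¹‖_∞`. -/
def shortReturnConst {E : Type*} [NormedAddCommGroup E] [NormedSpace ℝ E]
    {M : Type*} [TopologicalSpace M] [ChartedSpace E M]
    [RiemannianBundle (fun x : M => TangentSpace 𝓘(ℝ, E) x)]
    (T : M ≃ₘ^2⟮𝓘(ℝ, E), 𝓘(ℝ, E)⟯ M) : ℝ :=
  (4 * Real.log (supNormDeriv E T + supNormDeriv E T.symm))⁻¹

end

/-! Write t = √|log ρ| and D = log A. If D ≤ 0 there is nothing to count, so let D > 0 and 𝔞 =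
1/(4D).

If `B_ρ(c)` meets its n-th image, then T^n moves c by at most 2 A^n ρ. Repeating this N / n times,
with N = ⌊𝔞 t²⌋, replaces n by a multiple in (N/2, N] that moves c by at most r = 2 N A^N ρ. Since
A^N ≤ ρ^(-1/4), r is still tiny. It therefore suffices to bound the measure of points that are
nearly periodic with a period comparable to N (`veryShortReturns_subset`).

Put b = ⌊δ t⌋. Columns of the tower higher than b have little mass (`tsum_high_columns_le`). From
the others at most b steps lead to the base, and r grows only by the factor A^b (`towerMeasure_le`).
In the base, discard the points for which, at an index up to N, a return time exceeds b or the orbit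
of the return map hits the exceptional set of (B3). For every remaining point of period n there is a
q with q b ≥ n > N/2 whose q-th return occurs at a time in [n, n + b]. Two such points x, y in one
q-cylinder of an unstable leaf are C₀ α^q-close. Since T^n x is near x and T^n y near y, the images
T^n x, T^n y are close too, and at most b further steps keep the q-th returns within σ = e^(-t)/3.
So the q-th return, which maps the cylinder onto a full leaf, sends the bad points into one small
ball, and bounded distortion gives them an equally small proportion of the cylinder
(`nhat_le_of_close`).

Distortion concerns the reference measures, whereas (B3) concerns the conditional measures of m. The
bridge is an equidistribution argument: a density with respect to the reference measure is nearly
constant, up to a small L¹ error, on long cylinders, so iterates of a conditional measure are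
comparable to averages of normalised reference measures (`asymptotic`). Invariance of m removes the
error term (`measure_comparable`), and restriction to unions of leaves gives a comparison leaf by
leaf (`nhat_le`).

With N of order t² and b of order t, the errors b N b^(-λ), b N t^(-λ/2), b N² e^(-ς' t) and the
mass of the high columns are all O(t^(-(λ-9)/2)) = O(|log ρ|^(-(λ-9)/4)). -/

section
-- The derivative bound is a Lipschitz constant.
variable {E : Type*} [NormedAddCommGroup E] [NormedSpace ℝ E]
  {M : Type*} [TopologicalSpace M] [ChartedSpace E M] [IsManifold 𝓘(ℝ, E) 1 M]
  [RiemannianBundle (fun x : M => TangentSpace 𝓘(ℝ, E) x)]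
  [IsContinuousRiemannianBundle E (fun x : M => TangentSpace 𝓘(ℝ, E) x)]

/-- Read in the trivialisations at x and f x, the derivative is continuous. Because the Riemannian
metric is continuous, passing to and from these trivialisations costs locally bounded factors. -/
lemma eventually_norm_mfderiv_le {f : M → M} (hf : ContMDiff 𝓘(ℝ, E) 𝓘(ℝ, E) 1 f) (x : M) :
    ∃ C : ℝ, ∀ᶠ y in 𝓝 x, ‖mfderiv 𝓘(ℝ, E) 𝓘(ℝ, E) f y‖ ≤ C := by
  obtain ⟨C₁, hC₁, h₁⟩ := eventually_norm_trivializationAt_lt E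
    (fun x : M => TangentSpace 𝓘(ℝ, E) x) x
  obtain ⟨C₂, hC₂, h₂⟩ := eventually_norm_symmL_trivializationAt_lt E
    (fun x : M => TangentSpace 𝓘(ℝ, E) x) (f x)
  have hcont : ContinuousAt (inTangentCoordinates 𝓘(ℝ, E) 𝓘(ℝ, E) id f
      (mfderiv 𝓘(ℝ, E) 𝓘(ℝ, E) f) x) x :=
    (ContMDiffAt.mfderiv_const (m := 0) (hf.contMDiffAt (x := x)) (by simp)).continuousAt
  set g := inTangentCoordinates 𝓘(ℝ, E) 𝓘(ℝ, E) id f (mfderiv 𝓘(ℝ, E) 𝓘(ℝ, E) f) x with hg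
  have h₃ : ∀ᶠ y in 𝓝 x, ‖g y‖ < ‖g x‖ + 1 :=
    hcont.norm.eventually_lt_const (by linarith)
  have h₂' := hf.continuous.continuousAt.eventually h₂
  have hs : ∀ᶠ y in 𝓝 x, y ∈ (trivializationAt E (fun x : M => TangentSpace 𝓘(ℝ, E) x) x).baseSet :=
    (trivializationAt E (fun x : M => TangentSpace 𝓘(ℝ, E) x) x).open_baseSet.mem_nhds (FiberBundle.mem_baseSet_trivializationAt' x)
  have hs' : ∀ᶠ y in 𝓝 x,
      f y ∈ (trivializationAt E (fun x : M => TangentSpace 𝓘(ℝ, E) x) (f x)).baseSet :=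
    hf.continuous.continuousAt.eventually
      ((trivializationAt E (fun x : M => TangentSpace 𝓘(ℝ, E) x) (f x)).open_baseSet.mem_nhds
        (FiberBundle.mem_baseSet_trivializationAt' (f x)))
  refine ⟨C₂ * ((‖g x‖ + 1) * C₁), ?_⟩
  filter_upwards [h₁, h₂', h₃, hs, hs'] with y hy₁ hy₂ hy₃ hys hys'
  refine ContinuousLinearMap.opNorm_le_bound _ (by positivity) fun v => ?_
  have key : mfderiv 𝓘(ℝ, E) 𝓘(ℝ, E) f y v =
      (trivializationAt E (fun x : M => TangentSpace 𝓘(ℝ, E) x) (f x)).symmL ℝ (f y)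
        (g y ((trivializationAt E (fun x : M => TangentSpace 𝓘(ℝ, E) x) x).continuousLinearMapAt
          ℝ y v)) := by
    rw [hg]
    simp only [inTangentCoordinates, ContinuousLinearMap.inCoordinates, id]
    have e1 := (trivializationAt E (fun x : M => TangentSpace 𝓘(ℝ, E) x) x).symmL_continuousLinearMapAt (R := ℝ) hys v
    have e2 := (trivializationAt E (fun x : M => TangentSpace 𝓘(ℝ, E) x) (f x)).symmL_continuousLinearMapAt (R := ℝ) hys' (mfderiv 𝓘(ℝ, E) 𝓘(ℝ, E) f y v)
    conv_lhs => rw [← e2, ← e1]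
    rfl
  rw [key]
  calc _ ≤ C₂ * ‖g y ((trivializationAt E (fun x : M => TangentSpace 𝓘(ℝ, E) x) x).continuousLinearMapAt
          ℝ y v)‖ := ContinuousLinearMap.le_of_opNorm_le _ hy₂.le _
    _ ≤ C₂ * ((‖g x‖ + 1) * ‖(trivializationAt E (fun x : M => TangentSpace 𝓘(ℝ, E) x) x).continuousLinearMapAt
          ℝ y v‖) := by
        gcongr; exact ContinuousLinearMap.le_of_opNorm_le _ hy₃.le _
    _ ≤ C₂ * ((‖g x‖ + 1) * (C₁ * ‖v‖)) := by
        gcongr; exact ContinuousLinearMap.le_of_opNorm_le _ hy₁.le _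
    _ = _ := by ring

/-- Needed to make `supNormDeriv` meaningful: the real supremum of an unbounded family would be the
default value 0. -/
lemma bddAbove_norm_mfderiv [CompactSpace M] {f : M → M}
    (hf : ContMDiff 𝓘(ℝ, E) 𝓘(ℝ, E) 1 f) :
    BddAbove (range fun x : M => ‖mfderiv 𝓘(ℝ, E) 𝓘(ℝ, E) f x‖) := by
  choose C hC using fun x => eventually_norm_mfderiv_le hf x
  obtain ⟨t, -, ht⟩ := isCompact_univ.elim_nhds_subcover (fun x => {y | ‖mfderiv 𝓘(ℝ, E) 𝓘(ℝ, E) f y‖ ≤ C x})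
    fun x _ => hC x
  obtain ⟨B, hB⟩ := (t.finite_toSet.image C).bddAbove
  refine ⟨B, ?_⟩
  rintro _ ⟨y, rfl⟩
  obtain ⟨x, hx, hy⟩ := mem_iUnion₂.1 (ht (mem_univ y))
  exact le_trans hy (hB (mem_image_of_mem C hx))
end

section
variable {E : Type*} [NormedAddCommGroup E] [NormedSpace ℝ E]
  {M : Type*} [MetricSpace M] [ChartedSpace E M] [IsManifold 𝓘(ℝ, E) 1 M]
  [RiemannianBundle (fun x : M => TangentSpace 𝓘(ℝ, E) x)]
  [IsContinuousRiemannianBundle E (fun x : M => TangentSpace 𝓘(ℝ, E) x)]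
  [IsRiemannianManifold 𝓘(ℝ, E) M] [CompactSpace M]

-- A curve from x to y is mapped to a curve from f x to f y whose length is larger by at most the
-- supremum of the derivative; take the infimum over curves.
open Manifold in
lemma dist_le_supNormDeriv_mul_dist {f : M → M} (hf : ContMDiff 𝓘(ℝ, E) 𝓘(ℝ, E) 1 f) (x y : M) :
    dist (f x) (f y) ≤ supNormDeriv E f * dist x y := by
  have hbdd := bddAbove_norm_mfderiv hf
  have h0 : 0 ≤ supNormDeriv E f := Real.iSup_nonneg fun x => ContinuousLinearMap.opNorm_nonneg _
  have hle : ∀ z, ‖mfderiv 𝓘(ℝ, E) 𝓘(ℝ, E) f z‖ ≤ supNormDeriv E f := fun z => le_ciSup hbdd z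
  suffices h : edist (f x) (f y) ≤ ENNReal.ofReal (supNormDeriv E f) * edist x y by
    rw [edist_dist, edist_dist, ← ENNReal.ofReal_mul h0] at h
    exact (ENNReal.ofReal_le_ofReal_iff (by positivity)).1 h
  rw [IsRiemannianManifold.out (I := 𝓘(ℝ, E)) (f x), IsRiemannianManifold.out (I := 𝓘(ℝ, E)) x y]
  refine le_of_forall_gt_imp_ge_of_dense fun r hr => ?_
  obtain ⟨r', hr', hr'r⟩ : ∃ r', riemannianEDist 𝓘(ℝ, E) x y < r' ∧
      ENNReal.ofReal (supNormDeriv E f) * r' ≤ r := by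
    -- If the factor vanishes, any curve of finite length will do, and one exists because the
    -- distance is finite.
    by_cases hs : ENNReal.ofReal (supNormDeriv E f) = 0
    · refine ⟨⊤, ?_, by simp [hs]⟩
      rw [← IsRiemannianManifold.out (I := 𝓘(ℝ, E)) x y]; exact edist_lt_top x y
    · refine ⟨r / ENNReal.ofReal (supNormDeriv E f), ?_, ?_⟩
      · rwa [ENNReal.lt_div_iff_mul_lt (Or.inl hs) (Or.inl ENNReal.ofReal_ne_top), mul_comm]
      · exact ENNReal.mul_div_le
  obtain ⟨γ, h0γ, h1γ, hγ, hlen⟩ := exists_lt_of_riemannianEDist_lt hr'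
  have hfγ : ContMDiffOn 𝓘(ℝ, ℝ) 𝓘(ℝ, E) 1 (f ∘ γ) (Icc 0 1) := hf.comp_contMDiffOn hγ
  refine (riemannianEDist_le_pathELength hfγ (by simp [h0γ]) (by simp [h1γ])
    zero_le_one).trans (le_trans ?_ ((mul_le_mul_right hlen.le _).trans hr'r))
  rw [pathELength_eq_lintegral_mfderiv_Ioo, pathELength_eq_lintegral_mfderiv_Ioo,
    ← lintegral_const_mul' _ _ ENNReal.ofReal_ne_top]
  refine setLIntegral_mono' measurableSet_Ioo fun t ht => ?_
  have hγt : MDifferentiableAt 𝓘(ℝ, ℝ) 𝓘(ℝ, E) γ t :=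
    (hγ.contMDiffAt (Icc_mem_nhds ht.1 ht.2)).mdifferentiableAt one_ne_zero
  have hft : MDifferentiableAt 𝓘(ℝ, E) 𝓘(ℝ, E) f (γ t) :=
    (hf.contMDiffAt).mdifferentiableAt one_ne_zero
  rw [mfderiv_comp t hft hγt]
  have := ContinuousLinearMap.le_of_opNorm_le _ (hle (γ t)) (mfderiv 𝓘(ℝ, ℝ) 𝓘(ℝ, E) γ t 1)
  rw [← ofReal_norm, ← ofReal_norm, ← ENNReal.ofReal_mul h0]
  exact ENNReal.ofReal_le_ofReal this
end

/-! ### Combinatorics of the return map. -/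

namespace YoungTower

variable {M : Type*} [MeasurableSpace M] {T : M → M} {ι : Type*}

lemma base_unique (Y : YoungTower T ι) {i j : ι} {x : M} (hi : x ∈ Y.base i) (hj : x ∈ Y.base j) :
    i = j := by
  by_contra hne
  exact (Set.disjoint_left.1 (Y.base_disjoint hne)) hi hj

lemma ret_of_mem (Y : YoungTower T ι) {i : ι} {x : M} (hx : x ∈ Y.base i) : Y.ret x = Y.R i := by
  classical
  have h : ∃ i, x ∈ Y.base i := ⟨i, hx⟩
  have hi : h.choose = i := Y.base_unique h.choose_spec hx
  simp only [ret, returnTime, dif_pos h, hi]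

lemma ret_of_forall_notMem (Y : YoungTower T ι) {x : M} (hx : ¬ ∃ i, x ∈ Y.base i) :
    Y.ret x = 0 := by
  simp [ret, returnTime, dif_neg hx]

lemma That_of_mem (Y : YoungTower T ι) {i : ι} {x : M} (hx : x ∈ Y.base i) :
    Y.That x = T^[Y.R i] x := by
  rw [That, Y.ret_of_mem hx]

lemma That_of_forall_notMem (Y : YoungTower T ι) {x : M} (hx : ¬ ∃ i, x ∈ Y.base i) :
    Y.That x = x := by
  rw [That, Y.ret_of_forall_notMem hx]; rfl

lemma measurable_ret [Countable ι] (Y : YoungTower T ι) : Measurable Y.ret := by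
  refine measurable_to_countable' fun n => ?_
  -- The second set is non-empty only for n = 0, the default value off the pieces.
  have : Y.ret ⁻¹' {n} = (⋃ i ∈ {i | Y.R i = n}, Y.base i) ∪
      {x | n = 0 ∧ x ∈ (⋃ i, Y.base i)ᶜ} := by
    ext x
    by_cases h : ∃ i, x ∈ Y.base i
    · obtain ⟨i, hi⟩ := h
      have h1 : x ∈ ⋃ i, Y.base i := mem_iUnion.2 ⟨i, hi⟩
      simp only [mem_preimage, mem_singleton_iff, Y.ret_of_mem hi, mem_union, mem_iUnion₂]
      constructor
      · exact fun h => Or.inl ⟨i, h, hi⟩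
      · rintro (⟨j, hj, hxj⟩ | h)
        · rw [← Y.ret_of_mem hi, Y.ret_of_mem hxj]; exact hj
        · exact absurd h1 h.2
    · have h1 : x ∉ ⋃ i, Y.base i := fun h' => h (mem_iUnion.1 h')
      simp only [mem_preimage, mem_singleton_iff, Y.ret_of_forall_notMem h, mem_union, mem_iUnion₂]
      constructor
      · exact fun h => Or.inr ⟨h.symm, h1⟩
      · rintro (⟨j, hj, hxj⟩ | h)
        · exact absurd ⟨j, hxj⟩ h
        · exact h.1.symm
  rw [this]
  refine (MeasurableSet.biUnion (to_countable _) fun i _ => Y.measurableSet_base i).union ?_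
  by_cases hn : n = 0
  · have := (MeasurableSet.iUnion fun i => Y.measurableSet_base i).compl
    convert this using 1
    ext x; simp [hn]
  · simp [hn]

lemma measurable_That [Countable ι] (Y : YoungTower T ι) (hT : Measurable T) :
    Measurable Y.That := by
  intro S hS
  have : Y.That ⁻¹' S = ⋃ n, (Y.ret ⁻¹' {n} ∩ T^[n] ⁻¹' S) := by
    ext x
    simp [That]
  rw [this]
  exact MeasurableSet.iUnion fun n =>
    (Y.measurable_ret (measurableSet_singleton n)).inter (hT.iterate n hS)

lemma That_mem_of_mem_base (Y : YoungTower T ι) {i : ι} {x : M} (hx : x ∈ Y.base i) :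
    Y.That x ∈ Y.Λ := by
  have h := Y.markov_unstable i x hx
  have : T^[Y.R i] x ∈ Y.unstable (T^[Y.R i] x) ∩ Y.Λ :=
    h ▸ mem_image_of_mem _ ⟨Y.mem_unstable x (Y.base_subset i hx), hx⟩
  rw [Y.That_of_mem hx]; exact this.2

lemma That_mem (Y : YoungTower T ι) {x : M} (hx : x ∈ Y.Λ) : Y.That x ∈ Y.Λ := by
  by_cases h : ∃ i, x ∈ Y.base i
  · obtain ⟨i, hi⟩ := h
    exact Y.That_mem_of_mem_base hi
  · rwa [Y.That_of_forall_notMem h]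

lemma iterate_That_mem (Y : YoungTower T ι) {x : M} (hx : x ∈ Y.Λ) (n : ℕ) :
    Y.That^[n] x ∈ Y.Λ := by
  induction n with
  | zero => exact hx
  | succ n ih => rw [Function.iterate_succ_apply']; exact Y.That_mem ih

lemma That_image_leaf (Y : YoungTower T ι) {i : ι} {x : M} (hx : x ∈ Y.base i) :
    Y.That '' (Y.unstable x ∩ Y.base i) = Y.unstable (Y.That x) ∩ Y.Λ := by
  rw [Y.That_of_mem hx, ← Y.markov_unstable i x hx]
  exact image_congr fun y hy => Y.That_of_mem hy.2

lemma That_mem_stable (Y : YoungTower T ι) {i : ι} {x y : M} (hx : x ∈ Y.base i)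
    (hy : y ∈ Y.Λ) (h : y ∈ Y.stable x) : y ∈ Y.base i ∧ Y.That y ∈ Y.stable (Y.That x) := by
  have hyi : y ∈ Y.base i := Y.stable_subset_base i x hx ⟨h, hy⟩
  refine ⟨hyi, ?_⟩
  rw [Y.That_of_mem hx, Y.That_of_mem hyi]
  exact (Y.markov_stable i x hx (mem_image_of_mem _ ⟨h, hy⟩)).1

/-- Two points lie in a common cylinder of order `n` of the return map. -/
def SameCyl (Y : YoungTower T ι) (n : ℕ) (x y : M) : Prop :=
  ∀ k < n, ∃ i, Y.That^[k] x ∈ Y.base i ∧ Y.That^[k] y ∈ Y.base i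

lemma sameCyl_succ (Y : YoungTower T ι) (n : ℕ) (x y : M) :
    Y.SameCyl (n + 1) x y ↔
      (∃ i, x ∈ Y.base i ∧ y ∈ Y.base i) ∧ Y.SameCyl n (Y.That x) (Y.That y) := by
  constructor
  · intro h
    exact ⟨h 0 (Nat.succ_pos n), fun k hk => h (k + 1) (Nat.succ_lt_succ hk)⟩
  · rintro ⟨h0, h⟩ k hk
    cases k with
    | zero => exact h0
    | succ k => exact h k (Nat.lt_of_succ_lt_succ hk)

lemma SameCyl.le_sepTime {Y : YoungTower T ι} {n : ℕ} {x y : M} (h : Y.SameCyl n x y) :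
    (n : ℕ∞) ≤ Y.sepTime x y := by
  refine le_iInf₂ fun k hk => ?_
  by_contra hlt
  exact hk (h k (by exact_mod_cast not_le.1 hlt))

lemma sepTime_eq_top (Y : YoungTower T ι) {x y : M} (h : ∀ n, Y.SameCyl n x y) :
    Y.sepTime x y = ⊤ := by
  refine ENat.eq_top_iff_forall_ge.2 fun n => (h n).le_sepTime

lemma SameCyl.symm {Y : YoungTower T ι} {n : ℕ} {x y : M} (h : Y.SameCyl n x y) :
    Y.SameCyl n y x := fun k hk => (h k hk).imp fun _ hi => hi.symm

lemma SameCyl.mono {Y : YoungTower T ι} {n k : ℕ} {x y : M} (h : Y.SameCyl n x y) (hk : k ≤ n) :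
    Y.SameCyl k x y := fun j hj => h j (hj.trans_le hk)

/-- The image of a union of points of a leaf in a cylinder of order `n` under the `n`-th power of
the return map. -/
lemma iterate_That_image (Y : YoungTower T ι) (n : ℕ) {x : M} (hx : x ∈ Y.Λ)
    (hxx : Y.SameCyl n x x) :
    Y.That^[n] '' {z ∈ Y.unstable x ∩ Y.Λ | Y.SameCyl n x z} =
      Y.unstable (Y.That^[n] x) ∩ Y.Λ := by
  induction n generalizing x with
  | zero =>
    have : {z ∈ Y.unstable x ∩ Y.Λ | Y.SameCyl 0 x z} = Y.unstable x ∩ Y.Λ := by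
      ext z; simp [SameCyl]
    rw [this]; simp
  | succ n ih =>
    obtain ⟨⟨i, hi, -⟩, h⟩ := (Y.sameCyl_succ n x x).1 hxx
    rw [Function.iterate_succ_apply, ← ih (Y.That_mem hx) h, Function.iterate_succ, image_comp]
    -- The Markov property peels off the first return: the cylinder of order n + 1 in the leaf of x
    -- maps onto the cylinder of order n in the leaf of its image.
    congr 1
    ext z
    constructor
    · rintro ⟨y, ⟨⟨hyu, hyΛ⟩, hy⟩, rfl⟩
      obtain ⟨⟨j, hj, hyj⟩, hy'⟩ := (Y.sameCyl_succ n x y).1 hy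
      have hij : Y.That y ∈ Y.unstable (Y.That x) ∩ Y.Λ :=
        Y.That_image_leaf hj ▸ mem_image_of_mem _ ⟨hyu, hyj⟩
      exact ⟨hij, hy'⟩
    · rintro ⟨hz, hz'⟩
      obtain ⟨y, hy, rfl⟩ := (Y.That_image_leaf hi).symm ▸ hz
      exact ⟨y, ⟨⟨hy.1, Y.base_subset i hy.2⟩, (Y.sameCyl_succ n x y).2 ⟨⟨i, hi, hy.2⟩, hz'⟩⟩, rfl⟩

lemma unstable_iterate_That_eq (Y : YoungTower T ι) {n : ℕ} {x y : M} (hx : x ∈ Y.Λ)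
    (hy : y ∈ Y.Λ) (hxy : y ∈ Y.unstable x) (h : Y.SameCyl n x y) :
    Y.unstable (Y.That^[n] y) = Y.unstable (Y.That^[n] x) := by
  have : Y.That^[n] y ∈ Y.unstable (Y.That^[n] x) ∩ Y.Λ := by
    rw [← Y.iterate_That_image n hx fun k hk => (h k hk).imp fun _ hi => ⟨hi.1, hi.1⟩]
    exact mem_image_of_mem _ ⟨⟨hxy, hy⟩, h⟩
  exact Y.unstable_eq _ (Y.iterate_That_mem hx n) _ this.2 this.1

end YoungTower

/-! ### Bounded distortion of the iterated return map. -/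

lemma powENat_le_pow {α : ℝ} (hα : α ∈ Ioo (0 : ℝ) 1) {n : ℕ} {s : ℕ∞} (h : (n : ℕ∞) ≤ s) :
    powENat α s ≤ α ^ n := by
  unfold powENat
  split_ifs with hs
  · exact pow_nonneg hα.1.le _
  · lift s to ℕ using hs
    exact pow_le_pow_of_le_one hα.1.le hα.2.le (by exact_mod_cast h)

namespace YoungTower

variable {M : Type*} [MeasurableSpace M] {T : M → M} {ι : Type*}

/-- Distortion bound for the Jacobian of the return map along unstable leaves. -/
def Distortion (Y : YoungTower T ι) (J : M → ℝ) (C₀ α : ℝ) : Prop :=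
  ∀ x ∈ Y.Λ, ∀ y ∈ Y.Λ, 1 ≤ Y.sepTime x y → Y.unstable x = Y.unstable y →
      |Real.log (J x / J y)| ≤ C₀ * powENat α (Y.sepTime (Y.That x) (Y.That y))

lemma _root_.MeasurableEmbedding.iterate' {f : M → M} (hf : MeasurableEmbedding f) (n : ℕ) :
    MeasurableEmbedding f^[n] := by
  induction n with
  | zero => exact MeasurableEmbedding.id
  | succ n ih => exact ih.comp hf

/-- The constant c is the product of the Jacobians along the orbit of x. Within the cylinder the
first factor varies by at most exp(C₀ α^(n-1)), since after one return n - 1 symbols are still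
shared, and later factors contribute smaller powers down to α^0. The exponents add up to a geometric
sum. -/
lemma exists_jacobian_bound (Y : YoungTower T ι) (hT : MeasurableEmbedding T) {J : M → ℝ}
    (hJ : Y.IsJacobian J) {C₀ α : ℝ} (hC₀ : 0 < C₀) (hα : α ∈ Ioo (0 : ℝ) 1)
    (hd : Y.Distortion J C₀ α) (n : ℕ) :
    ∀ x ∈ Y.Λ, Y.SameCyl n x x → ∃ c : ℝ, 0 < c ∧ ∀ F, MeasurableSet F →
      F ⊆ {z ∈ Y.unstable x ∩ Y.Λ | Y.SameCyl n x z} →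
      Y.mhat (Y.That^[n] x) (Y.That^[n] '' F) ≤
        ENNReal.ofReal (c * Real.exp (C₀ * ∑ i ∈ Finset.range n, α ^ i)) * Y.mhat x F ∧
      ENNReal.ofReal (c * Real.exp (-(C₀ * ∑ i ∈ Finset.range n, α ^ i))) * Y.mhat x F ≤
        Y.mhat (Y.That^[n] x) (Y.That^[n] '' F) := by
  induction n with
  | zero =>
    intro x hx _
    refine ⟨1, one_pos, fun F hF _ => ?_⟩
    simp
  | succ n ih =>
    intro x hx hxx
    obtain ⟨⟨i, hi, -⟩, h⟩ := (Y.sameCyl_succ n x x).1 hxx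
    obtain ⟨c, hc, hcF⟩ := ih (Y.That x) (Y.That_mem hx) h
    have hJx := hJ.pos i x hi
    refine ⟨c * J x, by positivity, fun F hF hFsub => ?_⟩
    have hFi : F ⊆ Y.unstable x ∩ Y.base i := by
      intro z hz
      obtain ⟨⟨hzu, hzΛ⟩, hz'⟩ := hFsub hz
      obtain ⟨⟨j, hj, hzj⟩, -⟩ := (Y.sameCyl_succ n x z).1 hz'
      have : i = j := Y.base_unique hi hj
      exact ⟨hzu, this ▸ hzj⟩
    have him : Y.That '' F = T^[Y.R i] '' F :=
      image_congr fun y hy => Y.That_of_mem (hFi hy).2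
    have hF1 : MeasurableSet (Y.That '' F) := by
      rw [him]; exact (hT.iterate' _).measurableSet_image.2 hF
    have hF1sub : Y.That '' F ⊆
        {z ∈ Y.unstable (Y.That x) ∩ Y.Λ | Y.SameCyl n (Y.That x) z} := by
      rintro _ ⟨z, hz, rfl⟩
      have hz' := ((Y.sameCyl_succ n x z).1 (hFsub hz).2).2
      have : Y.That z ∈ Y.unstable (Y.That x) ∩ Y.Λ :=
        Y.That_image_leaf hi ▸ mem_image_of_mem _ (hFi hz)
      exact ⟨this, hz'⟩
    have hint : Y.mhat (Y.That x) (Y.That '' F) = ∫⁻ y in F, ENNReal.ofReal (J y) ∂(Y.mhat x) := by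
      rw [him, Y.That_of_mem hi]
      exact hJ.image i x hi F hFi hF
    have hJb : ∀ z ∈ F, J x * Real.exp (-(C₀ * α ^ n)) ≤ J z ∧
        J z ≤ J x * Real.exp (C₀ * α ^ n) := by
      intro z hz
      obtain ⟨⟨hzu, hzΛ⟩, hz'⟩ := hFsub hz
      have hsep : 1 ≤ Y.sepTime z x :=
        le_trans (by exact_mod_cast Nat.succ_pos n) hz'.symm.le_sepTime
      have h1 := hd z hzΛ x hx hsep (Y.unstable_eq x hx z hzΛ hzu)
      have h2 : powENat α (Y.sepTime (Y.That z) (Y.That x)) ≤ α ^ n :=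
        powENat_le_pow hα ((Y.sameCyl_succ n x z).1 hz').2.symm.le_sepTime
      have h3 : |Real.log (J z / J x)| ≤ C₀ * α ^ n :=
        h1.trans (mul_le_mul_of_nonneg_left h2 hC₀.le)
      have hJz := hJ.pos i z (hFi hz).2
      have h4 : J z = J x * Real.exp (Real.log (J z / J x)) := by
        rw [Real.exp_log (by positivity)]; field_simp
      obtain ⟨h5, h6⟩ := abs_le.1 h3
      constructor
      · rw [h4]; gcongr
      · rw [h4]; gcongr
    have hup : Y.mhat (Y.That x) (Y.That '' F) ≤
        ENNReal.ofReal (J x * Real.exp (C₀ * α ^ n)) * Y.mhat x F := by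
      rw [hint, ← setLIntegral_const]
      exact setLIntegral_mono' hF fun z hz => ENNReal.ofReal_le_ofReal (hJb z hz).2
    have hlo : ENNReal.ofReal (J x * Real.exp (-(C₀ * α ^ n))) * Y.mhat x F ≤
        Y.mhat (Y.That x) (Y.That '' F) := by
      rw [hint, ← setLIntegral_const]
      exact setLIntegral_mono' hF fun z hz => ENNReal.ofReal_le_ofReal (hJb z hz).1
    obtain ⟨hA, hB⟩ := hcF _ hF1 hF1sub
    rw [Function.iterate_succ_apply, Function.iterate_succ, image_comp]
    constructor
    · refine hA.trans ((mul_le_mul_right hup _).trans_eq ?_)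
      rw [← mul_assoc, ← ENNReal.ofReal_mul (by positivity), Finset.sum_range_succ, mul_add,
        Real.exp_add]
      congr 2; ring
    · refine le_trans (le_of_eq ?_) ((mul_le_mul_right hlo _).trans hB)
      rw [← mul_assoc, ← ENNReal.ofReal_mul (by positivity), Finset.sum_range_succ, mul_add,
        neg_add, Real.exp_add]
      congr 2; ring

end YoungTower

/-! ### Cylinders, proportions in cylinders, and the mass of the leaves. -/

namespace YoungTower

variable {M : Type*} [MeasurableSpace M] {T : M → M} {ι : Type*}

/-- The cylinder of order `n` of the return map with itinerary `w`. -/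
def cyl (Y : YoungTower T ι) (n : ℕ) (w : Fin n → ι) : Set M :=
  {x | x ∈ Y.Λ ∧ ∀ k : Fin n, Y.That^[k] x ∈ Y.base (w k)}

lemma measurableSet_cyl [Countable ι] (Y : YoungTower T ι) (hT : Measurable T) (n : ℕ)
    (w : Fin n → ι) : MeasurableSet (Y.cyl n w) := by
  have : Y.cyl n w = Y.Λ ∩ ⋂ k : Fin n, Y.That^[k] ⁻¹' (Y.base (w k)) := by
    ext x; simp [cyl]
  rw [this]
  exact Y.measurableSet_Λ.inter (MeasurableSet.iInter fun k =>
    ((Y.measurable_That hT).iterate k) (Y.measurableSet_base _))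

lemma sameCyl_of_mem_cyl (Y : YoungTower T ι) {n : ℕ} {w : Fin n → ι} {x y : M}
    (hx : x ∈ Y.cyl n w) (hy : y ∈ Y.cyl n w) : Y.SameCyl n x y :=
  fun k hk => ⟨w ⟨k, hk⟩, hx.2 ⟨k, hk⟩, hy.2 ⟨k, hk⟩⟩

lemma mem_cyl_of_sameCyl (Y : YoungTower T ι) {n : ℕ} {w : Fin n → ι} {x y : M}
    (hx : x ∈ Y.cyl n w) (hy : y ∈ Y.Λ) (h : Y.SameCyl n x y) : y ∈ Y.cyl n w := by
  refine ⟨hy, fun k => ?_⟩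
  obtain ⟨i, hi, hi'⟩ := h k k.2
  rwa [Y.base_unique (hx.2 k) hi]

lemma exists_mem_cyl (Y : YoungTower T ι) {n : ℕ} {x : M} (hx : x ∈ Y.Λ)
    (h : Y.SameCyl n x x) : ∃ w, x ∈ Y.cyl n w := by
  choose w hw using fun k : Fin n => h k k.2
  exact ⟨w, hx, fun k => (hw k).1⟩

lemma pairwise_disjoint_cyl (Y : YoungTower T ι) (n : ℕ) :
    Pairwise fun w w' : Fin n → ι => Disjoint (Y.cyl n w) (Y.cyl n w') := by
  intro w w' hne
  refine Set.disjoint_left.2 fun x hx hx' => hne ?_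
  ext k
  exact Y.base_unique (hx.2 k) (hx'.2 k)

lemma sameCyl_iff_self (Y : YoungTower T ι) {n : ℕ} {x : M} :
    Y.SameCyl n x x ↔ ∀ k < n, ∃ i, Y.That^[k] x ∈ Y.base i := by
  simp [SameCyl]

lemma measurableSet_sameCyl_self [Countable ι] (Y : YoungTower T ι) (hT : Measurable T) (n : ℕ) :
    MeasurableSet {y | Y.SameCyl n y y} := by
  have : {y | Y.SameCyl n y y} = ⋂ k : Fin n, Y.That^[k] ⁻¹' (⋃ i, Y.base i) := by
    ext x
    simp [sameCyl_iff_self, Fin.forall_iff]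
  rw [this]
  exact MeasurableSet.iInter fun k => ((Y.measurable_That hT).iterate k)
    (MeasurableSet.iUnion fun i => Y.measurableSet_base i)

/-- The bound for the distortion of iterates of the return map in a cylinder. -/
noncomputable def distConst (C₀ α : ℝ) : ℝ := Real.exp (C₀ * (1 - α)⁻¹)

lemma one_le_distConst {C₀ α : ℝ} (hC₀ : 0 < C₀) (hα : α ∈ Ioo (0 : ℝ) 1) :
    1 ≤ distConst C₀ α :=
  Real.one_le_exp (mul_nonneg hC₀.le (inv_nonneg.2 (by linarith [hα.2])))

lemma exists_jacobian_bound' (Y : YoungTower T ι) (hT : MeasurableEmbedding T) {J : M → ℝ}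
    (hJ : Y.IsJacobian J) {C₀ α : ℝ} (hC₀ : 0 < C₀) (hα : α ∈ Ioo (0 : ℝ) 1)
    (hd : Y.Distortion J C₀ α) (n : ℕ) {x : M} (hx : x ∈ Y.Λ) (hxx : Y.SameCyl n x x) :
    ∃ c : ℝ, 0 < c ∧ ∀ F, MeasurableSet F →
      F ⊆ {z ∈ Y.unstable x ∩ Y.Λ | Y.SameCyl n x z} →
      Y.mhat (Y.That^[n] x) (Y.That^[n] '' F) ≤
        ENNReal.ofReal (c * distConst C₀ α) * Y.mhat x F ∧
      ENNReal.ofReal c * Y.mhat x F ≤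
        ENNReal.ofReal (distConst C₀ α) * Y.mhat (Y.That^[n] x) (Y.That^[n] '' F) := by
  obtain ⟨c, hc, h⟩ := Y.exists_jacobian_bound hT hJ hC₀ hα hd n x hx hxx
  have hs : ∑ i ∈ Finset.range n, α ^ i ≤ (1 - α)⁻¹ := by
    rw [← tsum_geometric_of_lt_one hα.1.le hα.2]
    exact (summable_geometric_of_lt_one hα.1.le hα.2).sum_le_tsum _
      fun i _ => pow_nonneg hα.1.le i
  have hs' := mul_le_mul_of_nonneg_left hs hC₀.le
  refine ⟨c, hc, fun F hF hFs => ?_⟩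
  obtain ⟨h1, h2⟩ := h F hF hFs
  refine ⟨h1.trans ?_, ?_⟩
  · gcongr
    exact Real.exp_le_exp.2 hs'
  · refine le_trans ?_ (mul_le_mul_right h2 _)
    rw [← mul_assoc, ← ENNReal.ofReal_mul (zero_le_one.trans (one_le_distConst hC₀ hα))]
    gcongr
    rw [distConst, mul_left_comm, ← Real.exp_add]
    have : (1:ℝ) ≤ Real.exp (C₀ * (1 - α)⁻¹ + -(C₀ * ∑ i ∈ Finset.range n, α ^ i)) :=
      Real.one_le_exp (by linarith)
    nlinarith

/-- Bounded distortion for the iterates of the return map on a cylinder of an unstable leaf. -/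
lemma mhat_cyl_inter_preimage [Countable ι] (Y : YoungTower T ι) (hT : MeasurableEmbedding T)
    {J : M → ℝ} (hJ : Y.IsJacobian J) {C₀ α : ℝ} (hC₀ : 0 < C₀) (hα : α ∈ Ioo (0 : ℝ) 1)
    (hd : Y.Distortion J C₀ α) {n : ℕ} {w : Fin n → ι} {x : M} (hx : x ∈ Y.cyl n w)
    {S : Set M} (hS : MeasurableSet S) :
    Y.mhat x (Y.cyl n w ∩ Y.That^[n] ⁻¹' S) * Y.mhat (Y.That^[n] x) univ ≤
      ENNReal.ofReal (distConst C₀ α) ^ 2 * (Y.mhat x (Y.cyl n w) * Y.mhat (Y.That^[n] x) S) ∧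
    Y.mhat x (Y.cyl n w) * Y.mhat (Y.That^[n] x) S ≤
      ENNReal.ofReal (distConst C₀ α) ^ 2 *
        (Y.mhat x (Y.cyl n w ∩ Y.That^[n] ⁻¹' S) * Y.mhat (Y.That^[n] x) univ) := by
  have hxΛ := hx.1
  have hxx := Y.sameCyl_of_mem_cyl hx hx
  obtain ⟨c, hc, h⟩ := Y.exists_jacobian_bound' hT hJ hC₀ hα hd n hxΛ hxx
  set K := distConst C₀ α with hK
  have hK0 : 0 ≤ K := zero_le_one.trans (one_le_distConst hC₀ hα)
  have hZ : {z ∈ Y.unstable x ∩ Y.Λ | Y.SameCyl n x z} = Y.cyl n w ∩ (Y.unstable x ∩ Y.Λ) := by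
    ext z
    constructor
    · rintro ⟨hz, hz'⟩; exact ⟨Y.mem_cyl_of_sameCyl hx hz.2 hz', hz⟩
    · rintro ⟨hz, hz'⟩; exact ⟨hz', Y.sameCyl_of_mem_cyl hx hz⟩
  have hZm : MeasurableSet (Y.cyl n w ∩ (Y.unstable x ∩ Y.Λ)) :=
    (Y.measurableSet_cyl hT.measurable n w).inter
      ((Y.measurableSet_unstable x hxΛ).inter Y.measurableSet_Λ)
  have himg := Y.iterate_That_image n hxΛ hxx
  rw [hZ] at himg
  have hTn := (Y.measurable_That hT.measurable).iterate n
  have key : ∀ S, MeasurableSet S →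
      Y.mhat (Y.That^[n] x) S ≤
        ENNReal.ofReal (c * K) * Y.mhat x (Y.cyl n w ∩ Y.That^[n] ⁻¹' S) ∧
      ENNReal.ofReal c * Y.mhat x (Y.cyl n w ∩ Y.That^[n] ⁻¹' S) ≤
        ENNReal.ofReal K * Y.mhat (Y.That^[n] x) S := by
    intro S hS
    have h1 := h ((Y.cyl n w ∩ (Y.unstable x ∩ Y.Λ)) ∩ Y.That^[n] ⁻¹' S) (hZm.inter (hTn hS))
      (by rw [hZ]; exact inter_subset_left)
    rw [image_inter_preimage, himg] at h1
    have e1 : Y.mhat (Y.That^[n] x) (Y.unstable (Y.That^[n] x) ∩ Y.Λ ∩ S) =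
        Y.mhat (Y.That^[n] x) S := by
      rw [inter_comm]
      exact measure_inter_conull (Y.mhat_leaf _ (Y.iterate_That_mem hxΛ n))
    have e2 : Y.mhat x ((Y.cyl n w ∩ (Y.unstable x ∩ Y.Λ)) ∩ Y.That^[n] ⁻¹' S) =
        Y.mhat x (Y.cyl n w ∩ Y.That^[n] ⁻¹' S) := by
      rw [inter_right_comm]
      exact measure_inter_conull (Y.mhat_leaf _ hxΛ)
    rwa [e1, e2] at h1
  have e3 : Y.cyl n w ∩ Y.That^[n] ⁻¹' univ = Y.cyl n w := by simp
  -- Pairing the estimate for S with the one for the whole leaf eliminates the unknown c; this is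
  -- why the distortion constant enters squared.
  obtain ⟨a1, a2⟩ := key S hS
  obtain ⟨b1, b2⟩ := key univ MeasurableSet.univ
  rw [e3] at b1 b2
  rw [ENNReal.ofReal_mul hc.le] at a1 b1
  constructor
  · calc _ ≤ Y.mhat x (Y.cyl n w ∩ Y.That^[n] ⁻¹' S) *
          (ENNReal.ofReal c * ENNReal.ofReal K * Y.mhat x (Y.cyl n w)) := by gcongr
      _ = (ENNReal.ofReal c * Y.mhat x (Y.cyl n w ∩ Y.That^[n] ⁻¹' S)) *
          (ENNReal.ofReal K * Y.mhat x (Y.cyl n w)) := by ring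
      _ ≤ (ENNReal.ofReal K * Y.mhat (Y.That^[n] x) S) *
          (ENNReal.ofReal K * Y.mhat x (Y.cyl n w)) := by gcongr
      _ = _ := by ring
  · calc _ ≤ Y.mhat x (Y.cyl n w) *
          (ENNReal.ofReal c * ENNReal.ofReal K * Y.mhat x (Y.cyl n w ∩ Y.That^[n] ⁻¹' S)) := by
            gcongr
      _ = (ENNReal.ofReal c * Y.mhat x (Y.cyl n w)) *
          (ENNReal.ofReal K * Y.mhat x (Y.cyl n w ∩ Y.That^[n] ⁻¹' S)) := by ring
      _ ≤ (ENNReal.ofReal K * Y.mhat (Y.That^[n] x) univ) *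
          (ENNReal.ofReal K * Y.mhat x (Y.cyl n w ∩ Y.That^[n] ⁻¹' S)) := by gcongr
      _ = _ := by ring

/-- Almost every point of an unstable leaf returns infinitely often. -/
lemma mhat_not_sameCyl [Countable ι] (Y : YoungTower T ι) (hT : MeasurableEmbedding T) {J : M → ℝ}
    (hJ : Y.IsJacobian J) {C₀ α : ℝ} (hC₀ : 0 < C₀) (hα : α ∈ Ioo (0 : ℝ) 1)
    (hd : Y.Distortion J C₀ α) (n : ℕ) :
    ∀ x ∈ Y.Λ, Y.mhat x {y | ¬ Y.SameCyl n y y} = 0 := by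
  induction n with
  | zero => intro x _; simp [SameCyl]
  | succ n ih =>
    intro x hx
    let F : ι → Set M := fun i =>
      (Y.unstable x ∩ Y.base i) ∩ Y.That ⁻¹' {y | Y.SameCyl n y y}ᶜ
    have hFm : ∀ i, MeasurableSet (F i) := fun i =>
      ((Y.measurableSet_unstable x hx).inter (Y.measurableSet_base i)).inter
        (Y.measurable_That hT.measurable (Y.measurableSet_sameCyl_self hT.measurable n).compl)
    have hsub : {y | ¬ Y.SameCyl (n + 1) y y} ⊆
        (Y.unstable x ∩ Y.Λ)ᶜ ∪ (Y.Λ \ ⋃ i, Y.base i) ∪ ⋃ i, F i := by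
      intro y hy
      by_cases h1 : y ∈ Y.unstable x ∩ Y.Λ
      · by_cases h2 : ∃ i, y ∈ Y.base i
        · obtain ⟨i, hi⟩ := h2
          refine Or.inr (mem_iUnion.2 ⟨i, ⟨h1.1, hi⟩, fun h3 => hy ?_⟩)
          exact (Y.sameCyl_succ n y y).2 ⟨⟨i, hi, hi⟩, h3⟩
        · exact Or.inl (Or.inr ⟨h1.2, fun h => h2 (mem_iUnion.1 h)⟩)
      · exact Or.inl (Or.inl h1)
    refine measure_mono_null hsub (measure_union_null (measure_union_null (Y.mhat_leaf x hx)
      (Y.mhat_cover x hx)) (measure_iUnion_null fun i => ?_))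
    rcases (F i).eq_empty_or_nonempty with he | ⟨y, ⟨hyu, hyi⟩, -⟩
    · simp [he]
    have hyΛ := Y.base_subset i hyi
    have hu := Y.unstable_eq x hx y hyΛ hyu
    rw [Y.mhat_eq x hx y hyΛ hu.symm]
    -- The lower Jacobian bound for a single return pulls null sets back: the image of `F i` lies in
    -- the set that is null by the induction hypothesis.
    obtain ⟨c, hc, h⟩ := Y.exists_jacobian_bound' hT hJ hC₀ hα hd 1 hyΛ
      ((Y.sameCyl_succ 0 y y).2 ⟨⟨i, hyi, hyi⟩, by simp [SameCyl]⟩)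
    have h2 := (h (F i) (hFm i) (by
      rintro z ⟨⟨hzu, hzi⟩, -⟩
      exact ⟨⟨hu ▸ hzu, Y.base_subset i hzi⟩,
        (Y.sameCyl_succ 0 y z).2 ⟨⟨i, hyi, hzi⟩, by simp [SameCyl]⟩⟩)).2
    have h3 : Y.mhat (Y.That^[1] y) (Y.That^[1] '' F i) = 0 := by
      refine measure_mono_null ?_ (ih (Y.That y) (Y.That_mem hyΛ))
      rintro _ ⟨z, hz, rfl⟩
      exact hz.2
    rw [h3, mul_zero, nonpos_iff_eq_zero, mul_eq_zero] at h2
    exact h2.resolve_left (by simpa using hc)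

lemma ae_forall_sameCyl [Countable ι] (Y : YoungTower T ι) (hT : MeasurableEmbedding T) {J : M → ℝ}
    (hJ : Y.IsJacobian J) {C₀ α : ℝ} (hC₀ : 0 < C₀) (hα : α ∈ Ioo (0 : ℝ) 1)
    (hd : Y.Distortion J C₀ α) {x : M} (hx : x ∈ Y.Λ) :
    ∀ᵐ y ∂(Y.mhat x), ∀ n, Y.SameCyl n y y :=
  ae_all_iff.2 fun n => Y.mhat_not_sameCyl hT hJ hC₀ hα hd n x hx

lemma holonomy_spec (Y : YoungTower T ι) {x y : M} (hx : x ∈ Y.Λ) (hy : y ∈ Y.Λ) :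
    Y.holonomy x y ∈ Y.unstable x ∩ Y.stable y ∧ Y.holonomy x y ∈ Y.Λ := by
  obtain ⟨z, hz, h⟩ := Y.product x hx y hy
  have hne : (Y.unstable x ∩ Y.stable y).Nonempty := h ▸ singleton_nonempty z
  have h1 : Y.holonomy x y = hne.some := by simp [holonomy, dif_pos hne]
  have h2 : Y.holonomy x y ∈ Y.unstable x ∩ Y.stable y := h1 ▸ hne.some_mem
  refine ⟨h2, ?_⟩
  rw [h] at h2
  rwa [h2]

lemma sameCyl_of_stable (Y : YoungTower T ι) (n : ℕ) : ∀ {y z : M}, z ∈ Y.Λ →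
    z ∈ Y.stable y → Y.SameCyl n y y → Y.SameCyl n y z := by
  induction n with
  | zero => intro y z _ _ _ k hk; simp at hk
  | succ n ih =>
    intro y z hz hzy h
    obtain ⟨⟨i, hi, -⟩, h'⟩ := (Y.sameCyl_succ n y y).1 h
    obtain ⟨h1, h2⟩ := Y.That_mem_stable hi hz hzy
    exact (Y.sameCyl_succ n y z).2 ⟨⟨i, hi, h1⟩, ih (Y.That_mem hz) h2 h'⟩

/-- The reference measures of the unstable leaves are bounded from below. -/
lemma exists_le_mhat [Countable ι] (Y : YoungTower T ι) (hT : MeasurableEmbedding T) {J : M → ℝ}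
    (hJ : Y.IsJacobian J) {C₀ α : ℝ} (hC₀ : 0 < C₀) (hα : α ∈ Ioo (0 : ℝ) 1)
    (hd : Y.Distortion J C₀ α)
    (hc : ∀ x ∈ Y.Λ, ∀ y ∈ Y.Λ, Y.stable x = Y.stable y → Y.sepTime x y = ⊤ →
      ∀ n : ℕ, ∃ P : ℝ, IsInfProd (fun k => J (Y.That^[k] x) / J (Y.That^[k] y)) n P ∧
        Real.log P ≤ C₀ * α ^ n)
    (hh : ∀ x ∈ Y.Λ, ∀ x' ∈ Y.Λ, ∃ D : M → ℝ, Measurable D ∧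
      (∀ y ∈ Y.unstable x ∩ Y.Λ, Y.sepTime y (Y.holonomy x' y) = ⊤ →
        IsInfProd (fun k => J (Y.That^[k] y) / J (Y.That^[k] (Y.holonomy x' y))) 0 (D y)) ∧
      ∀ F ⊆ Y.unstable x ∩ Y.Λ, MeasurableSet F →
        Y.mhat x' (Y.holonomy x' '' F) = ∫⁻ y in F, ENNReal.ofReal (D y) ∂(Y.mhat x))
    {x x' : M} (hx : x ∈ Y.Λ) (hx' : x' ∈ Y.Λ) :
    ENNReal.ofReal (Real.exp (-C₀)) * Y.mhat x univ ≤ Y.mhat x' univ := by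
  obtain ⟨D, hDm, hD, hF⟩ := hh x hx x' hx'
  have hlm : MeasurableSet (Y.unstable x ∩ Y.Λ) :=
    (Y.measurableSet_unstable x hx).inter Y.measurableSet_Λ
  have h1 := hF _ Subset.rfl hlm
  have hleaf : Y.mhat x (Y.unstable x ∩ Y.Λ) = Y.mhat x univ := by
    rw [← univ_inter (Y.unstable x ∩ Y.Λ)]
    exact measure_inter_conull (Y.mhat_leaf x hx)
  rw [← hleaf, ← setLIntegral_const]
  refine le_trans ?_ (h1.symm.le.trans (measure_mono (subset_univ _)))
  refine lintegral_mono_ae ?_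
  rw [ae_restrict_iff' hlm]
  filter_upwards [Y.ae_forall_sameCyl hT hJ hC₀ hα hd hx] with y hy hyl
  refine ENNReal.ofReal_le_ofReal ?_
  obtain ⟨⟨-, hzs⟩, hzΛ⟩ := Y.holonomy_spec hx' hyl.2
  set z := Y.holonomy x' y
  have hyz : ∀ n, Y.SameCyl n y z := fun n => Y.sameCyl_of_stable n hzΛ hzs (hy n)
  obtain ⟨hDpos, hDt⟩ := hD y hyl (Y.sepTime_eq_top hyz)
  -- Condition (c) bounds products from above only. Applied to the reversed pair (z, y) it bounds
  -- the inverse of D y, hence D y from below.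
  obtain ⟨P, ⟨hP, hPt⟩, hlogP⟩ := hc z hzΛ y hyl.2 (Y.stable_eq y hyl.2 z hzΛ hzs)
    (Y.sepTime_eq_top fun n => (hyz n).symm) 0
  have h2 := hDt.mul hPt
  have h3 : D y * P = 1 := by
    refine tendsto_nhds_unique h2 (tendsto_const_nhds.congr fun N => ?_)
    rw [← Finset.prod_mul_distrib]
    symm
    refine Finset.prod_eq_one fun k _ => ?_
    obtain ⟨i, hi1, hi2⟩ := hyz (k + 1) k (Nat.lt_succ_self k)
    have h1 := (hJ.pos i _ hi1).ne'
    have h2 := (hJ.pos i _ hi2).ne'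
    change J (Y.That^[k] y) / J (Y.That^[k] z) * (J (Y.That^[k] z) / J (Y.That^[k] y)) = 1
    field_simp
  have h4 : P ≤ Real.exp C₀ := by
    rw [← Real.log_le_iff_le_exp hP]; simpa using hlogP
  rw [Real.exp_neg]
  have h5 : D y = P⁻¹ := eq_inv_of_mul_eq_one_left h3
  rw [h5]
  gcongr

end YoungTower

/-! ### Integral comparisons on partitions and in the limit. -/

lemma lintegral_eq_tsum_of_partition {X β : Type*} [MeasurableSpace X] [Countable β]
    {ν : Measure X} {Z : β → Set X} (hZm : ∀ b, MeasurableSet (Z b))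
    (hZd : Pairwise fun b b' => Disjoint (Z b) (Z b')) (hZc : ∀ᵐ x ∂ν, ∃ b, x ∈ Z b)
    (f : X → ℝ≥0∞) : ∫⁻ x, f x ∂ν = ∑' b, ∫⁻ x in Z b, f x ∂ν := by
  rw [← lintegral_iUnion hZm hZd, Measure.restrict_eq_self_of_ae_mem]
  filter_upwards [hZc] with x hx using mem_iUnion.2 hx

/-- Comparison of two integrals of a function that is close in `L¹` to a function which is nearly
constant on the pieces of a partition, under a comparison of the masses of the pieces. -/
lemma lintegral_mul_le_of_partition {X β : Type*} [MeasurableSpace X] [Countable β]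
    {ν : Measure X} {Z : β → Set X} (hZm : ∀ b, MeasurableSet (Z b))
    (hZd : Pairwise fun b b' => Disjoint (Z b) (Z b')) (hZc : ∀ᵐ x ∂ν, ∃ b, x ∈ Z b)
    {p q h g d : X → ℝ≥0∞} (hp : Measurable p) (hq : Measurable q)
    (hd : Measurable d) (hp1 : ∀ x, p x ≤ 1) (hq1 : ∀ x, q x ≤ 1) {K ε : ℝ≥0∞}
    (hK : ∀ b, ∫⁻ x in Z b, p x ∂ν ≤ K * ∫⁻ x in Z b, q x ∂ν)
    (hosc : ∀ b, ∀ y ∈ Z b, ∀ z ∈ Z b, g y ≤ g z + ε)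
    (h1 : ∀ x, h x ≤ g x + d x) (h2 : ∀ x, g x ≤ h x + d x) :
    ∫⁻ x, h x * p x ∂ν ≤
      K * ∫⁻ x, h x * q x ∂ν + ((1 + K) * ∫⁻ x, d x ∂ν + ε * ν univ) := by
  have hA : ∫⁻ x, h x * p x ∂ν ≤ ∫⁻ x, g x * p x ∂ν + ∫⁻ x, d x ∂ν := by
    rw [← lintegral_add_right _ hd]
    refine lintegral_mono fun x => ?_
    calc h x * p x ≤ (g x + d x) * p x := by gcongr; exact h1 x
      _ = g x * p x + d x * p x := add_mul _ _ _
      _ ≤ g x * p x + d x * 1 := by gcongr; exact hp1 x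
      _ = _ := by rw [mul_one]
  have hB : ∫⁻ x, g x * q x ∂ν ≤ ∫⁻ x, h x * q x ∂ν + ∫⁻ x, d x ∂ν := by
    rw [← lintegral_add_right _ hd]
    refine lintegral_mono fun x => ?_
    calc g x * q x ≤ (h x + d x) * q x := by gcongr; exact h2 x
      _ = h x * q x + d x * q x := add_mul _ _ _
      _ ≤ h x * q x + d x * 1 := by gcongr; exact hq1 x
      _ = _ := by rw [mul_one]
  have hC : ∫⁻ x, g x * p x ∂ν ≤ K * ∫⁻ x, g x * q x ∂ν + ε * ν univ := by
    rw [lintegral_eq_tsum_of_partition hZm hZd hZc, lintegral_eq_tsum_of_partition hZm hZd hZc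
      (fun x => g x * q x), ← lintegral_one, lintegral_eq_tsum_of_partition hZm hZd hZc
      (fun _ => (1 : ℝ≥0∞)), ← ENNReal.tsum_mul_left, ← ENNReal.tsum_mul_left, ← ENNReal.tsum_add]
    refine ENNReal.tsum_le_tsum fun b => ?_
    -- On the piece, g lies between a and a + ε, so the comparison of masses can simply be
    -- multiplied by a; only ε times the mass of the piece is lost.
    set a := ⨅ z : Z b, g z with ha
    have hga : ∀ y ∈ Z b, g y ≤ a + ε := by
      intro y hy
      rw [ha, ENNReal.iInf_add]
      exact le_iInf fun z => hosc b y hy z z.2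
    have hag : ∀ y ∈ Z b, a ≤ g y := fun y hy => iInf_le (fun z : Z b => g z) ⟨y, hy⟩
    calc ∫⁻ x in Z b, g x * p x ∂ν ≤ ∫⁻ x in Z b, (a * p x + ε * 1) ∂ν := by
          refine setLIntegral_mono' (hZm b) fun y hy => ?_
          calc g y * p y ≤ (a + ε) * p y := by gcongr; exact hga y hy
            _ = a * p y + ε * p y := add_mul _ _ _
            _ ≤ _ := by gcongr; exact hp1 y
      _ = a * ∫⁻ x in Z b, p x ∂ν + ε * ∫⁻ x in Z b, 1 ∂ν := by
          rw [lintegral_add_left (hp.const_mul a), lintegral_const_mul _ hp,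
            lintegral_const_mul _ measurable_const]
      _ ≤ a * (K * ∫⁻ x in Z b, q x ∂ν) + ε * ∫⁻ x in Z b, 1 ∂ν := by gcongr; exact hK b
      _ = K * ∫⁻ x in Z b, a * q x ∂ν + ε * ∫⁻ x in Z b, 1 ∂ν := by
          rw [lintegral_const_mul _ hq, mul_left_comm]
      _ ≤ _ := by
          gcongr 2 with x
          exact setLIntegral_mono' (hZm b) fun y hy => mul_le_mul_left (hag y hy) _
  calc _ ≤ ∫⁻ x, g x * p x ∂ν + ∫⁻ x, d x ∂ν := hA
    _ ≤ (K * (∫⁻ x, h x * q x ∂ν + ∫⁻ x, d x ∂ν) + ε * ν univ) + ∫⁻ x, d x ∂ν := by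
        gcongr; exact hC.trans (by gcongr)
    _ = _ := by ring

/-- Approximation of an integrable density by a uniformly continuous function. -/
lemma exists_unifContinuous_approx {X : Type*} [MetricSpace X] [CompactSpace X] [MeasurableSpace X]
    [BorelSpace X] (ν : Measure X) [IsFiniteMeasure ν] {f : X → ℝ} (hf : Integrable f ν)
    (hfm : Measurable f) {ε : ℝ≥0∞} (hε : ε ≠ 0) :
    ∃ (g d : X → ℝ≥0∞), Measurable d ∧ ∫⁻ x, d x ∂ν ≤ ε ∧
      (∀ x, ENNReal.ofReal (f x) ≤ g x + d x) ∧ (∀ x, g x ≤ ENNReal.ofReal (f x) + d x) ∧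
      ∀ η : ℝ, 0 < η → ∃ r > 0, ∀ y z, dist y z < r → g y ≤ g z + ENNReal.ofReal η := by
  obtain ⟨g, hg, -⟩ := hf.exists_boundedContinuous_lintegral_sub_le hε
  have haux : ∀ a b : ℝ, ENNReal.ofReal a ≤ ENNReal.ofReal b + ENNReal.ofReal |a - b| := by
    intro a b
    calc ENNReal.ofReal a ≤ ENNReal.ofReal (b + |a - b|) :=
          ENNReal.ofReal_le_ofReal (by linarith [le_abs_self (a - b)])
      _ ≤ _ := ENNReal.ofReal_add_le
  refine ⟨fun x => ENNReal.ofReal (g x), fun x => ENNReal.ofReal |f x - g x|,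
    ?_, ?_, fun x => haux _ _, fun x => ?_, ?_⟩
  · exact (hfm.sub g.continuous.measurable).abs.ennreal_ofReal
  · refine le_trans (le_of_eq ?_) hg
    refine lintegral_congr fun x => ?_
    rw [Real.enorm_eq_ofReal_abs]
  · have := haux (g x) (f x)
    rwa [abs_sub_comm] at this
  · intro η hη
    have huc := CompactSpace.uniformContinuous_of_continuous g.continuous
    obtain ⟨r, hr, h⟩ := Metric.uniformContinuous_iff.1 huc η hη
    refine ⟨r, hr, fun y z hyz => (haux (g y) (g z)).trans ?_⟩
    gcongr
    have := h hyz
    rw [Real.dist_eq] at this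
    exact this.le

/-- The truncated differences f n - K g n are dominated by 1 and tend to 0 almost everywhere, so
their integrals tend to 0. As the integrals of f n and g n do not depend on n, the limit inequality
is exact. -/
lemma le_mul_of_asymptotic_le {X : Type*} [MeasurableSpace X] {m : Measure X} [IsFiniteMeasure m]
    {f g : ℕ → X → ℝ≥0∞} (hf : ∀ n, Measurable (f n)) (hg : ∀ n, Measurable (g n))
    (hf1 : ∀ n, ∀ᵐ x ∂m, f n x ≤ 1) {a b K : ℝ≥0∞} (ha : ∀ n, ∫⁻ x, f n x ∂m = a)
    (hb : ∀ n, ∫⁻ x, g n x ∂m = b)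
    (h : ∀ᵐ x ∂m, ∀ ε : ℝ≥0∞, 0 < ε → ∃ N, ∀ n ≥ N, f n x ≤ K * g n x + ε) : a ≤ K * b := by
  have hlim : Tendsto (fun n => ∫⁻ x, f n x - K * g n x ∂m) atTop (𝓝 (∫⁻ _, 0 ∂m)) := by
    refine tendsto_lintegral_of_dominated_convergence (fun _ => 1)
      (fun n => (hf n).sub ((hg n).const_mul K)) (fun n => ?_) (by simp) ?_
    · filter_upwards [hf1 n] with x hx using tsub_le_self.trans hx
    · filter_upwards [h] with x hx
      rw [ENNReal.tendsto_atTop_zero]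
      intro ε hε
      obtain ⟨N, hN⟩ := hx ε hε
      exact ⟨N, fun n hn => tsub_le_iff_left.2 (hN n hn)⟩
  rw [lintegral_zero] at hlim
  have h2 : ∀ n, a ≤ ∫⁻ x, f n x - K * g n x ∂m + K * b := by
    intro n
    rw [← ha n, ← hb n, ← lintegral_const_mul _ (hg n),
      ← lintegral_add_right _ ((hg n).const_mul K)]
    exact lintegral_mono fun x => le_tsub_add
  have h3 := hlim.add (tendsto_const_nhds (x := K * b))
  rw [zero_add] at h3
  exact ge_of_tendsto' h3 h2

/-! ### Equidistribution on an unstable leaf. -/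

namespace YoungTower

section

variable {M : Type*} [MeasurableSpace M] {T : M → M} {ι : Type*}

/-- The normalised reference measure of a set. -/
noncomputable def nhat (Y : YoungTower T ι) (x : M) (S : Set M) : ℝ≥0∞ :=
  Y.mhat x S / Y.mhat x univ

lemma nhat_le_one (Y : YoungTower T ι) (x : M) (S : Set M) : Y.nhat x S ≤ 1 :=
  ENNReal.div_le_of_le_mul (by rw [one_mul]; exact measure_mono (subset_univ S))

lemma measurable_nhat (Y : YoungTower T ι) {S : Set M} (hS : MeasurableSet S) :
    Measurable fun x => Y.nhat x S :=
  (Y.mhat.measurable_coe hS).div (Y.mhat.measurable_coe MeasurableSet.univ)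

lemma nhat_eq (Y : YoungTower T ι) {x y : M} (hx : x ∈ Y.Λ) (hy : y ∈ Y.Λ)
    (h : Y.unstable y = Y.unstable x) (S : Set M) : Y.nhat y S = Y.nhat x S := by
  rw [nhat, nhat, Y.mhat_eq x hx y hy h.symm]

/-- The distortion constant of a measure under iterates of the return map. -/
noncomputable def sqDist (C₀ α : ℝ) : ℝ≥0∞ := ENNReal.ofReal (distConst C₀ α) ^ 2

lemma sqDist_ne_top (C₀ α : ℝ) : sqDist C₀ α ≠ ⊤ := ENNReal.pow_ne_top ENNReal.ofReal_ne_top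

end

variable {M : Type*} [MetricSpace M] [MeasurableSpace M] {T : M → M} {ι : Type*}

/-- The properties of a Young tower along unstable leaves: bounded distortion, backward
contraction and non-degenerate reference measures. -/
structure IsExpanding (Y : YoungTower T ι) (J : M → ℝ) (C₀ α : ℝ) : Prop where
  emb : MeasurableEmbedding T
  jac : Y.IsJacobian J
  pos : 0 < C₀
  mem : α ∈ Ioo (0 : ℝ) 1
  distortion : Y.Distortion J C₀ α
  contraction : ∀ n, 1 ≤ n → ∀ x ∈ Y.Λ, ∀ y ∈ Y.Λ, y ∈ Y.unstable x → Y.SameCyl n x y →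
    dist x y ≤ C₀ * α ^ n
  mhat_ne_zero : ∀ x ∈ Y.Λ, Y.mhat x univ ≠ 0

lemma IsExpanding.mhat_cyl [Countable ι] {Y : YoungTower T ι} {J : M → ℝ} {C₀ α : ℝ}
    (hY : Y.IsExpanding J C₀ α) {n : ℕ} {w : Fin n → ι} {x : M} (hx : x ∈ Y.cyl n w) {S : Set M}
    (hS : MeasurableSet S) :
    Y.mhat x (Y.cyl n w ∩ Y.That^[n] ⁻¹' S) ≤
      sqDist C₀ α * (Y.mhat x (Y.cyl n w) * Y.nhat (Y.That^[n] x) S) ∧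
    Y.mhat x (Y.cyl n w) * Y.nhat (Y.That^[n] x) S ≤
      sqDist C₀ α * Y.mhat x (Y.cyl n w ∩ Y.That^[n] ⁻¹' S) := by
  obtain ⟨h1, h2⟩ := Y.mhat_cyl_inter_preimage hY.emb hY.jac hY.pos hY.mem hY.distortion hx hS
  have hΛ := Y.iterate_That_mem hx.1 n
  have h0 := hY.mhat_ne_zero _ hΛ
  have := Y.mhat_finite _ hΛ
  have ht : Y.mhat (Y.That^[n] x) univ ≠ ⊤ := measure_ne_top _ _
  constructor
  · rw [← ENNReal.le_div_iff_mul_le (Or.inl h0) (Or.inl ht)] at h1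
    refine h1.trans_eq ?_
    rw [nhat, sqDist]; simp only [div_eq_mul_inv]; ring
  · rw [nhat, ← mul_div_assoc]
    refine ENNReal.div_le_of_le_mul (h2.trans_eq ?_)
    rw [sqDist, mul_assoc]

/-- The conditional measures of an absolutely continuous measure on an unstable leaf are
asymptotically equidistributed with bounded distortion. -/
lemma IsExpanding.asymptotic [CompactSpace M] [BorelSpace M] [Countable ι] {Y : YoungTower T ι}
    {J : M → ℝ} {C₀ α : ℝ}
    (hY : Y.IsExpanding J C₀ α) {x : M} (hx : x ∈ Y.Λ) {k : Measure M} [IsProbabilityMeasure k]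
    (hk : k ≪ Y.mhat x) {ε : ℝ≥0∞} (hε : 0 < ε) :
    ∃ N, ∀ n ≥ N, ∀ S, MeasurableSet S →
      k (Y.That^[n] ⁻¹' S) ≤ sqDist C₀ α * ∫⁻ y, Y.nhat (Y.That^[n] y) S ∂k + ε ∧
      ∫⁻ y, Y.nhat (Y.That^[n] y) S ∂k ≤ sqDist C₀ α * k (Y.That^[n] ⁻¹' S) + ε := by
  have := Y.mhat_finite x hx
  set ν := Y.mhat x with hν
  set K := sqDist C₀ α with hKdef
  have hKt : K ≠ ⊤ := sqDist_ne_top _ _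
  set f : M → ℝ := fun y => (k.rnDeriv ν y).toReal with hf
  have hfm : Measurable f := (Measure.measurable_rnDeriv k ν).ennreal_toReal
  have hfi : Integrable f ν := Measure.integrable_toReal_rnDeriv
  have hint : ∀ φ : M → ℝ≥0∞, Measurable φ →
      ∫⁻ y, ENNReal.ofReal (f y) * φ y ∂ν = ∫⁻ y, φ y ∂k := by
    intro φ hφ
    rw [← lintegral_rnDeriv_mul hk hφ.aemeasurable]
    refine lintegral_congr_ae ?_
    filter_upwards [Measure.rnDeriv_lt_top k ν] with y hy
    rw [hf, ENNReal.ofReal_toReal hy.ne]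
  -- Half of ε pays for the L¹ error δ of the continuous approximation of the density, the other
  -- half for its oscillation η on cylinders.
  obtain ⟨δ, hδ, hδε⟩ : ∃ δ : ℝ≥0∞, 0 < δ ∧ (1 + K) * δ ≤ ε / 2 := by
    refine ⟨ε / 2 / (1 + K), ENNReal.div_pos (ENNReal.half_pos hε.ne').ne' (by simp [hKt]), ?_⟩
    exact ENNReal.mul_div_le
  obtain ⟨η, hη, hηε⟩ : ∃ η : ℝ, 0 < η ∧ ENNReal.ofReal η * ν univ ≤ ε / 2 := by
    obtain ⟨η, hη, h⟩ := ENNReal.exists_nnreal_pos_mul_lt (measure_ne_top ν univ)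
      (ENNReal.half_pos hε.ne').ne'
    exact ⟨η, hη, by simpa using h.le⟩
  obtain ⟨g, d, hd, hdδ, hfg, hgf, hosc⟩ :=
    exists_unifContinuous_approx ν hfi hfm hδ.ne'
  obtain ⟨r, hr, hosc⟩ := hosc η hη
  obtain ⟨N, hN⟩ : ∃ N, ∀ n ≥ N, C₀ * α ^ n < r := by
    have : Tendsto (fun n => C₀ * α ^ n) atTop (𝓝 (C₀ * 0)) :=
      (tendsto_pow_atTop_nhds_zero_of_lt_one hY.mem.1.le hY.mem.2).const_mul _
    rw [mul_zero] at this
    exact eventually_atTop.1 (this.eventually_lt_const hr)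
  -- From N on, cylinders in the leaf have diameter below r; the contraction estimate needs order at
  -- least 1.
  refine ⟨max N 1, fun n hn S hS => ?_⟩
  have hTm := (Y.measurable_That hY.emb.measurable).iterate n
  have hlm : MeasurableSet (Y.unstable x ∩ Y.Λ) :=
    (Y.measurableSet_unstable x hx).inter Y.measurableSet_Λ
  let Z : (Fin n → ι) → Set M := fun w => Y.cyl n w ∩ (Y.unstable x ∩ Y.Λ)
  have hZm : ∀ w, MeasurableSet (Z w) := fun w =>
    (Y.measurableSet_cyl hY.emb.measurable n w).inter hlm
  have hZd : Pairwise fun w w' => Disjoint (Z w) (Z w') := fun w w' h =>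
    (Y.pairwise_disjoint_cyl n h).mono inter_subset_left inter_subset_left
  have hleaf : ∀ᵐ y ∂ν, y ∈ Y.unstable x ∩ Y.Λ := Y.mhat_leaf x hx
  have hZc : ∀ᵐ y ∂ν, ∃ w, y ∈ Z w := by
    filter_upwards [hleaf, Y.ae_forall_sameCyl hY.emb hY.jac hY.pos hY.mem hY.distortion hx]
      with y hy hyc
    obtain ⟨w, hw⟩ := Y.exists_mem_cyl hy.2 (hyc n)
    exact ⟨w, hw, hy⟩
  have hZosc : ∀ w, ∀ y ∈ Z w, ∀ z ∈ Z w, g y ≤ g z + ENNReal.ofReal η := by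
    intro w y hy z hz
    refine hosc y z (lt_of_le_of_lt ?_ (hN n (le_trans (le_max_left _ _) hn)))
    refine hY.contraction n (le_trans (le_max_right _ _) hn) y hy.2.2 z hz.2.2 ?_
      (Y.sameCyl_of_mem_cyl hy.1 hz.1)
    rw [Y.unstable_eq x hx y hy.2.2 hy.2.1]; exact hz.2.1
  set p : M → ℝ≥0∞ := (Y.That^[n] ⁻¹' S).indicator 1 with hp
  set q : M → ℝ≥0∞ := fun y => Y.nhat (Y.That^[n] y) S with hq
  have hpm : Measurable p := measurable_one.indicator (hTm hS)
  have hqm : Measurable q := (Y.measurable_nhat hS).comp hTm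
  have hp1 : ∀ y, p y ≤ 1 := fun y => indicator_le_self' (fun _ _ => zero_le) y
  have hq1 : ∀ y, q y ≤ 1 := fun y => Y.nhat_le_one _ _
  have hpk : ∫⁻ y, p y ∂k = k (Y.That^[n] ⁻¹' S) := lintegral_indicator_one (hTm hS)
  have hcomp : ∀ w, ∫⁻ y in Z w, p y ∂ν ≤ K * ∫⁻ y in Z w, q y ∂ν ∧
      ∫⁻ y in Z w, q y ∂ν ≤ K * ∫⁻ y in Z w, p y ∂ν := by
    intro w
    rcases (Z w).eq_empty_or_nonempty with he | ⟨z, hz⟩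
    · simp [he]
    have hzu := Y.unstable_eq x hx z hz.2.2 hz.2.1
    have hνz : ν = Y.mhat z := Y.mhat_eq x hx z hz.2.2 hzu.symm
    have e1 : ∫⁻ y in Z w, p y ∂ν = Y.mhat z (Y.cyl n w ∩ Y.That^[n] ⁻¹' S) := by
      rw [hp, lintegral_indicator_one (hTm hS), Measure.restrict_apply (hTm hS), ← hνz,
        inter_comm, inter_right_comm]
      exact measure_inter_conull (Y.mhat_leaf x hx)
    have e2 : ∫⁻ y in Z w, q y ∂ν = Y.mhat z (Y.cyl n w) * Y.nhat (Y.That^[n] z) S := by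
      -- The n-th return carries the whole piece into a single leaf, and `nhat` depends only on the
      -- leaf.
      have : ∀ y ∈ Z w, q y = Y.nhat (Y.That^[n] z) S := by
        intro y hy
        refine Y.nhat_eq (Y.iterate_That_mem hz.2.2 n) (Y.iterate_That_mem hy.2.2 n) ?_ S
        exact Y.unstable_iterate_That_eq hz.2.2 hy.2.2 (hzu ▸ hy.2.1)
          (Y.sameCyl_of_mem_cyl hz.1 hy.1)
      rw [setLIntegral_congr_fun (hZm w) this, setLIntegral_const, mul_comm, ← hνz]
      congr 1
      exact measure_inter_conull (Y.mhat_leaf x hx)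
    rw [e1, e2]
    exact hY.mhat_cyl hz.1 hS
  have herr : (1 + K) * ∫⁻ y, d y ∂ν + ENNReal.ofReal η * ν univ ≤ ε := by
    calc _ ≤ (1 + K) * δ + ε / 2 := by gcongr
      _ ≤ ε / 2 + ε / 2 := by gcongr
      _ = ε := ENNReal.add_halves ε
  have r1 := lintegral_mul_le_of_partition hZm hZd hZc hpm hqm hd hp1 hq1
    (fun w => (hcomp w).1) hZosc hfg hgf
  have r2 := lintegral_mul_le_of_partition hZm hZd hZc hqm hpm hd hq1 hp1
    (fun w => (hcomp w).2) hZosc hfg hgf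
  rw [hint p hpm, hint q hqm, hpk] at r1 r2
  exact ⟨r1.trans (by gcongr), r2.trans (by gcongr)⟩

end YoungTower

/-! ### Comparison of the SRB measure with the reference measures. -/

namespace YoungTower

section

variable {M : Type*} [MeasurableSpace M] {T : M → M} {ι : Type*}

lemma IsSRB.ae_mem {Y : YoungTower T ι} {m : Measure M} {κ : Kernel M M} (hm : Y.IsSRB m κ) :
    ∀ᵐ x ∂m, x ∈ Y.Λ := hm.carried

lemma IsSRB.lintegral_lintegral {Y : YoungTower T ι} {m : Measure M} {κ : Kernel M M}
    (hm : Y.IsSRB m κ) {φ : M → ℝ≥0∞} (hφ : Measurable φ) :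
    ∫⁻ x, ∫⁻ y, φ y ∂(κ x) ∂m = ∫⁻ y, φ y ∂m := by
  have h : m = m.bind κ := by
    ext S hS
    rw [Measure.bind_apply hS κ.aemeasurable, hm.disintegration S hS]
  conv_rhs => rw [h]
  rw [Measure.lintegral_bind κ.aemeasurable hφ.aemeasurable]

lemma IsSRB.measurePreserving [Countable ι] {Y : YoungTower T ι} {m : Measure M} {κ : Kernel M M}
    (hm : Y.IsSRB m κ) (hT : Measurable T) : MeasurePreserving Y.That m m :=
  ⟨Y.measurable_That hT, by
    ext S hS
    rw [Measure.map_apply (Y.measurable_That hT) hS, hm.invariant S hS]⟩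

end

variable {M : Type*} [MetricSpace M] [MeasurableSpace M] {T : M → M} {ι : Type*}

lemma IsExpanding.ae_sameCyl [Countable ι] {Y : YoungTower T ι} {J : M → ℝ} {C₀ α : ℝ}
    (hY : Y.IsExpanding J C₀ α) {m : Measure M} {κ : Kernel M M} (hm : Y.IsSRB m κ) :
    ∀ᵐ x ∂m, ∀ n, Y.SameCyl n x x := by
  refine ae_all_iff.2 fun n => ?_
  have hmeas := (Y.measurableSet_sameCyl_self hY.emb.measurable n).compl
  change m {x | Y.SameCyl n x x}ᶜ = 0
  rw [hm.disintegration _ hmeas, lintegral_eq_zero_iff (κ.measurable_coe hmeas)]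
  filter_upwards [hm.absolutelyContinuous, hm.ae_mem] with x hx hxΛ
  exact hx (Y.mhat_not_sameCyl hY.emb hY.jac hY.pos hY.mem hY.distortion n x hxΛ)

/-- An SRB measure is comparable to the average of the normalised reference measures. -/
lemma IsExpanding.measure_comparable [CompactSpace M] [BorelSpace M] [Countable ι]
    {Y : YoungTower T ι} {J : M → ℝ} {C₀ α : ℝ} (hY : Y.IsExpanding J C₀ α) {m : Measure M}
    [IsFiniteMeasure m] {κ : Kernel M M} (hm : Y.IsSRB m κ) {S : Set M} (hS : MeasurableSet S) :
    m S ≤ sqDist C₀ α * ∫⁻ x, Y.nhat x S ∂m ∧ ∫⁻ x, Y.nhat x S ∂m ≤ sqDist C₀ α * m S := by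
  have hTm := fun n => (Y.measurable_That hY.emb.measurable).iterate n
  have hpres := hm.measurePreserving hY.emb.measurable
  have hq : ∀ n, Measurable fun y => Y.nhat (Y.That^[n] y) S := fun n =>
    (Y.measurable_nhat hS).comp (hTm n)
  have hF : ∀ n, Measurable fun x => κ x (Y.That^[n] ⁻¹' S) := fun n =>
    κ.measurable_coe (hTm n hS)
  have hG : ∀ n, Measurable fun x => ∫⁻ y, Y.nhat (Y.That^[n] y) S ∂(κ x) := fun n =>
    (hq n).lintegral_kernel
  -- Disintegration and invariance make the integrals of both sequences independent of n.
  have hFi : ∀ n, ∫⁻ x, κ x (Y.That^[n] ⁻¹' S) ∂m = m S := fun n => by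
    rw [← hm.disintegration _ (hTm n hS)]
    exact (hpres.iterate n).measure_preimage hS.nullMeasurableSet
  have hGi : ∀ n, ∫⁻ x, ∫⁻ y, Y.nhat (Y.That^[n] y) S ∂(κ x) ∂m = ∫⁻ x, Y.nhat x S ∂m :=
    fun n => by
      rw [hm.lintegral_lintegral (hq n)]
      exact (hpres.iterate n).lintegral_comp (Y.measurable_nhat hS)
  have hF1 : ∀ n, ∀ᵐ x ∂m, κ x (Y.That^[n] ⁻¹' S) ≤ 1 := fun n => by
    filter_upwards [hm.ae_mem] with x hx
    have := hm.prob x hx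
    exact prob_le_one
  have hG1 : ∀ n, ∀ᵐ x ∂m, ∫⁻ y, Y.nhat (Y.That^[n] y) S ∂(κ x) ≤ 1 := fun n => by
    filter_upwards [hm.ae_mem] with x hx
    have := hm.prob x hx
    refine (lintegral_mono fun y => Y.nhat_le_one _ _).trans ?_
    simp
  have hasym : ∀ᵐ x ∂m, ∀ ε : ℝ≥0∞, 0 < ε → ∃ N, ∀ n ≥ N, ∀ S, MeasurableSet S →
      κ x (Y.That^[n] ⁻¹' S) ≤ sqDist C₀ α * ∫⁻ y, Y.nhat (Y.That^[n] y) S ∂(κ x) + ε ∧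
      ∫⁻ y, Y.nhat (Y.That^[n] y) S ∂(κ x) ≤ sqDist C₀ α * κ x (Y.That^[n] ⁻¹' S) + ε := by
    filter_upwards [hm.ae_mem, hm.absolutelyContinuous] with x hx hac ε hε
    have := hm.prob x hx
    exact hY.asymptotic hx hac hε
  constructor
  · refine le_mul_of_asymptotic_le hF hG hF1 hFi hGi ?_
    filter_upwards [hasym] with x hx ε hε
    obtain ⟨N, hN⟩ := hx ε hε
    exact ⟨N, fun n hn => (hN n hn S hS).1⟩
  · refine le_mul_of_asymptotic_le hG hF hG1 hGi hFi ?_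
    filter_upwards [hasym] with x hx ε hε
    obtain ⟨N, hN⟩ := hx ε hε
    exact ⟨N, fun n hn => (hN n hn S hS).2⟩

/-- The conditional measures of an SRB measure dominate the normalised reference measures. -/
lemma IsExpanding.nhat_le [CompactSpace M] [BorelSpace M] [Countable ι]
    {Y : YoungTower T ι} {J : M → ℝ} {C₀ α : ℝ} (hY : Y.IsExpanding J C₀ α) {m : Measure M}
    [IsFiniteMeasure m] {κ : Kernel M M} (hm : Y.IsSRB m κ) {S : Set M} (hS : MeasurableSet S) :
    ∀ᵐ x ∂m, Y.nhat x S ≤ sqDist C₀ α * κ x S := by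
  set K := sqDist C₀ α
  have hn := Y.measurable_nhat hS
  have hk : Measurable fun x => K * κ x S := (κ.measurable_coe hS).const_mul K
  -- The points where the claim fails. Both sides depend only on the leaf, so G is a union of traces
  -- of leaves, and intersecting S with G selects exactly these leaves.
  set G : Set M := {x | K * κ x S < Y.nhat x S} ∩ Y.Λ with hGdef
  have hG : MeasurableSet G := (measurableSet_lt hk hn).inter Y.measurableSet_Λ
  have hsat : ∀ x ∈ Y.Λ, ∀ y ∈ Y.unstable x ∩ Y.Λ, (y ∈ G ↔ x ∈ G) := by
    intro x hx y hy
    have hu := Y.unstable_eq x hx y hy.2 hy.1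
    have h1 := Y.nhat_eq hx hy.2 hu S
    have h2 := hm.leaf_eq x hx y hy.2 hu.symm
    change (K * κ y S < Y.nhat y S ∧ _) ↔ (K * κ x S < Y.nhat x S ∧ _)
    rw [h1, ← h2]
    exact and_congr_right fun _ => ⟨fun _ => hx, fun _ => hy.2⟩
  have hinter : ∀ x ∈ Y.Λ, ∀ ν : Measure M, ν (Y.unstable x ∩ Y.Λ)ᶜ = 0 →
      ν (S ∩ G) = G.indicator (fun _ => ν S) x := by
    intro x hx ν hν
    rw [← measure_inter_conull hν]
    by_cases hxG : x ∈ G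
    · rw [indicator_of_mem hxG, ← measure_inter_conull (s := S) hν]
      congr 1
      ext y
      constructor
      · exact fun h => ⟨h.1.1, h.2⟩
      · exact fun h => ⟨⟨h.1, (hsat x hx y h.2).2 hxG⟩, h.2⟩
    · rw [indicator_of_notMem hxG]
      have : S ∩ G ∩ (Y.unstable x ∩ Y.Λ) = ∅ := by
        ext y
        simp only [mem_empty_iff_false, iff_false]
        exact fun h => hxG ((hsat x hx y h.2).1 h.1.2)
      rw [this, measure_empty]
  have h1 : ∫⁻ x, Y.nhat x (S ∩ G) ∂m = ∫⁻ x in G, Y.nhat x S ∂m := by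
    rw [← lintegral_indicator hG]
    refine lintegral_congr_ae ?_
    filter_upwards [hm.ae_mem] with x hx
    rw [nhat, hinter x hx _ (Y.mhat_leaf x hx)]
    by_cases hxG : x ∈ G
    · simp [hxG, nhat]
    · simp [hxG]
  have h2 : K * m (S ∩ G) = ∫⁻ x in G, K * κ x S ∂m := by
    rw [lintegral_const_mul _ (κ.measurable_coe hS), hm.disintegration _ (hS.inter hG),
      ← lintegral_indicator hG]
    congr 1
    refine lintegral_congr_ae ?_
    filter_upwards [hm.ae_mem] with x hx
    exact hinter x hx _ (hm.leaf x hx)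
  have h3 := (hY.measure_comparable hm (hS.inter hG)).2
  rw [h1, h2] at h3
  -- On G the integrands are strictly ordered the wrong way, so positive mass would contradict the
  -- integrated comparison for S ∩ G.
  have hG0 : m G = 0 := by
    by_contra hne
    refine absurd h3 (not_le.2 ?_)
    refine setLIntegral_strict_mono hG hne hn ?_ (Eventually.of_forall fun x hx => hx.1)
    rw [← h2]
    exact ENNReal.mul_ne_top (sqDist_ne_top _ _) (measure_ne_top _ _)
  filter_upwards [hm.ae_mem, measure_eq_zero_iff_ae_notMem.1 hG0] with x hx hxG
  by_contra hlt
  exact hxG ⟨not_le.1 hlt, hx⟩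

/-- The leafwise comparison has a null set depending on the test set. Using only balls of radius 2σ
about a countable dense set gives one null set for all centres, at the price of tripling the radius.
-/
lemma IsExpanding.nhat_ball_le [CompactSpace M] [BorelSpace M] [Countable ι]
    {Y : YoungTower T ι} {J : M → ℝ} {C₀ α : ℝ} (hY : Y.IsExpanding J C₀ α) {m : Measure M}
    [IsFiniteMeasure m] {κ : Kernel M M} (hm : Y.IsSRB m κ) {σ : ℝ} (hσ : 0 < σ) :
    ∀ᵐ x ∂m, ∀ c, Y.nhat x (Metric.ball c σ) ≤ sqDist C₀ α * κ x (Metric.ball c (3 * σ)) := by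
  rcases isEmpty_or_nonempty M with h | h
  · exact Eventually.of_forall fun x => isEmptyElim x
  have := ae_all_iff.2 fun j : ℕ =>
    hY.nhat_le hm (Metric.isOpen_ball (x := TopologicalSpace.denseSeq M j) (ε := 2 * σ)).measurableSet
  filter_upwards [this] with x hx c
  obtain ⟨j, hj⟩ := (TopologicalSpace.denseRange_denseSeq M).exists_dist_lt c hσ
  calc Y.nhat x (Metric.ball c σ) ≤ Y.nhat x (Metric.ball (TopologicalSpace.denseSeq M j) (2 * σ)) := by
        refine ENNReal.div_le_div_right (measure_mono ?_) _
        exact Metric.ball_subset_ball' (by linarith)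
    _ ≤ _ := hx j
    _ ≤ _ := by
        gcongr
        exact Metric.ball_subset_ball' (by rw [dist_comm]; linarith)

/-- In each q-cylinder of the leaf, the q-th return sends all of W into one ball of radius σ about
the image of any point of W. By bounded distortion W takes at most the proportion K τ of that
cylinder, K being `sqDist C₀ α`; sum over cylinders. -/
lemma IsExpanding.nhat_le_of_close [BorelSpace M] [Countable ι]
    {Y : YoungTower T ι} {J : M → ℝ} {C₀ α : ℝ} (hY : Y.IsExpanding J C₀ α) {q : ℕ} {σ : ℝ}
    {τ : ℝ≥0∞} {W : Set M} (hW1 : ∀ x ∈ W, Y.SameCyl q x x)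
    (hW2 : ∀ x ∈ W, Y.nhat (Y.That^[q] x) (Metric.ball (Y.That^[q] x) σ) ≤ τ)
    (hW3 : ∀ x ∈ W, ∀ y ∈ W, y ∈ Y.unstable x → Y.SameCyl q x y →
      dist (Y.That^[q] y) (Y.That^[q] x) < σ) {x : M} (hx : x ∈ Y.Λ) :
    Y.nhat x W ≤ sqDist C₀ α * τ := by
  have hfin := Y.mhat_finite x hx
  refine ENNReal.div_le_of_le_mul ?_
  have hsub : W ⊆ (Y.unstable x ∩ Y.Λ)ᶜ ∪ ⋃ w : Fin q → ι, (W ∩ Y.cyl q w) := by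
    intro y hy
    by_cases hyl : y ∈ Y.unstable x ∩ Y.Λ
    · obtain ⟨w, hw⟩ := Y.exists_mem_cyl hyl.2 (hW1 y hy)
      exact Or.inr (mem_iUnion.2 ⟨w, hy, hw⟩)
    · exact Or.inl hyl
  have hpiece : ∀ w : Fin q → ι,
      Y.mhat x (W ∩ Y.cyl q w) ≤ sqDist C₀ α * τ * Y.mhat x (Y.cyl q w) := by
    intro w
    rw [← measure_inter_conull (s := W ∩ Y.cyl q w) (Y.mhat_leaf x hx)]
    rcases (W ∩ Y.cyl q w ∩ (Y.unstable x ∩ Y.Λ)).eq_empty_or_nonempty with he | ⟨z, hz⟩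
    · simp [he]
    have hzu := Y.unstable_eq x hx z hz.2.2 hz.2.1
    rw [Y.mhat_eq x hx z hz.2.2 hzu.symm]
    calc _ ≤ Y.mhat z (Y.cyl q w ∩ Y.That^[q] ⁻¹' (Metric.ball (Y.That^[q] z) σ)) := by
          refine measure_mono fun y hy => ⟨hy.1.2, ?_⟩
          exact hW3 z hz.1.1 y hy.1.1 (hzu ▸ hy.2.1) (Y.sameCyl_of_mem_cyl hz.1.2 hy.1.2)
      _ ≤ sqDist C₀ α * (Y.mhat z (Y.cyl q w) *
          Y.nhat (Y.That^[q] z) (Metric.ball (Y.That^[q] z) σ)) :=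
          (hY.mhat_cyl hz.1.2 Metric.isOpen_ball.measurableSet).1
      _ ≤ sqDist C₀ α * (Y.mhat z (Y.cyl q w) * τ) := by gcongr; exact hW2 z hz.1.1
      _ = _ := by ring
  calc Y.mhat x W ≤ Y.mhat x (Y.unstable x ∩ Y.Λ)ᶜ + ∑' w, Y.mhat x (W ∩ Y.cyl q w) :=
        (measure_mono hsub).trans ((measure_union_le _ _).trans
          (add_le_add_right (measure_iUnion_le _) _))
    _ ≤ 0 + ∑' w, sqDist C₀ α * τ * Y.mhat x (Y.cyl q w) := by
        rw [Y.mhat_leaf x hx]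
        gcongr with w
        exact hpiece w
    _ = sqDist C₀ α * τ * Y.mhat x (⋃ w, Y.cyl q w) := by
        rw [zero_add, ENNReal.tsum_mul_left, measure_iUnion (Y.pairwise_disjoint_cyl q)
          (Y.measurableSet_cyl hY.emb.measurable q)]
    _ ≤ _ := by gcongr; exact subset_univ _

lemma IsExpanding.measure_le_of_close [CompactSpace M] [BorelSpace M] [Countable ι]
    {Y : YoungTower T ι} {J : M → ℝ} {C₀ α : ℝ} (hY : Y.IsExpanding J C₀ α) {m : Measure M}
    [IsFiniteMeasure m] {κ : Kernel M M} (hm : Y.IsSRB m κ) {q : ℕ} {σ : ℝ}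
    {τ : ℝ≥0∞} {W : Set M} (hWm : MeasurableSet W) (hW1 : ∀ x ∈ W, Y.SameCyl q x x)
    (hW2 : ∀ x ∈ W, Y.nhat (Y.That^[q] x) (Metric.ball (Y.That^[q] x) σ) ≤ τ)
    (hW3 : ∀ x ∈ W, ∀ y ∈ W, y ∈ Y.unstable x → Y.SameCyl q x y →
      dist (Y.That^[q] y) (Y.That^[q] x) < σ) :
    m W ≤ sqDist C₀ α ^ 2 * τ * m univ := by
  calc m W ≤ sqDist C₀ α * ∫⁻ x, Y.nhat x W ∂m := (hY.measure_comparable hm hWm).1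
    _ ≤ sqDist C₀ α * ∫⁻ x, sqDist C₀ α * τ ∂m := by
        refine mul_le_mul_right ?_ _
        refine lintegral_mono_ae ?_
        filter_upwards [hm.ae_mem] with x hx
        exact hY.nhat_le_of_close hW1 hW2 hW3 hx
    _ = _ := by rw [lintegral_const]; ring

/-- Tail estimate for the return time with respect to an SRB measure. -/
lemma IsExpanding.measure_tail [CompactSpace M] [BorelSpace M] [Countable ι]
    {Y : YoungTower T ι} {J : M → ℝ} {C₀ α : ℝ} (hY : Y.IsExpanding J C₀ α) {m : Measure M}
    [IsFiniteMeasure m] {κ : Kernel M M} (hm : Y.IsSRB m κ) {lam : ℝ} (ht : Y.PolynomialTail lam)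
    {c : ℝ≥0∞} (hc : c ≠ 0) (hc' : ∀ x ∈ Y.Λ, c ≤ Y.mhat x univ) :
    ∃ C : ℝ, 0 < C ∧ ∀ k : ℕ, 1 ≤ k →
      m {y | k < Y.ret y} ≤ ENNReal.ofReal (C * (k : ℝ) ^ (-lam)) := by
  obtain ⟨C₁, hC₁, h⟩ := ht
  -- The tail hypothesis is not normalised; c⁻¹ comes from dividing by the mass of the leaf.
  set B : ℝ≥0∞ := sqDist C₀ α * (c⁻¹ * m univ) with hB
  have hBt : B ≠ ⊤ := ENNReal.mul_ne_top (sqDist_ne_top _ _)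
    (ENNReal.mul_ne_top (ENNReal.inv_ne_top.2 hc) (measure_ne_top _ _))
  refine ⟨(B.toReal + 1) * C₁, by positivity, fun k hk => ?_⟩
  have hm1 : MeasurableSet {y | k < Y.ret y} := Y.measurable_ret measurableSet_Ioi
  calc m {y | k < Y.ret y} ≤ sqDist C₀ α * ∫⁻ x, Y.nhat x {y | k < Y.ret y} ∂m :=
        (hY.measure_comparable hm hm1).1
    _ ≤ sqDist C₀ α * ∫⁻ x, ENNReal.ofReal (C₁ * (k : ℝ) ^ (-lam)) * c⁻¹ ∂m := by
        refine mul_le_mul_right ?_ _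
        refine lintegral_mono_ae ?_
        filter_upwards [hm.ae_mem] with x hx
        rw [nhat, div_eq_mul_inv]
        gcongr
        · exact h x hx k hk
        · exact hc' x hx
    _ = B * ENNReal.ofReal (C₁ * (k : ℝ) ^ (-lam)) := by rw [lintegral_const, hB]; ring
    _ ≤ ENNReal.ofReal (B.toReal + 1) * ENNReal.ofReal (C₁ * (k : ℝ) ^ (-lam)) := by
        gcongr
        rw [← ENNReal.ofReal_toReal hBt]
        refine ENNReal.ofReal_le_ofReal ?_
        rw [ENNReal.toReal_ofReal ENNReal.toReal_nonneg]
        linarith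
    _ = _ := by rw [← ENNReal.ofReal_mul (by positivity), mul_assoc]

end YoungTower

/-! ### From short returns to near-periodicity. -/

section

variable {M : Type*} [MetricSpace M] {T : M → M} {A : ℝ}

lemma dist_iterate_le (hA : 1 ≤ A) (hL : ∀ x y, dist (T x) (T y) ≤ A * dist x y) (n : ℕ) (x y : M) :
    dist (T^[n] x) (T^[n] y) ≤ A ^ n * dist x y := by
  induction n generalizing x y with
  | zero => simp
  | succ n ih =>
    rw [Function.iterate_succ_apply, Function.iterate_succ_apply, pow_succ, mul_assoc]
    exact (ih _ _).trans (mul_le_mul_of_nonneg_left (hL x y) (by positivity))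

/-- Telescoping over the k blocks of length n. The exponent k n - n, rather than k n, lets a later
factor A^n be absorbed without exceeding A^(k n). -/
lemma dist_iterate_mul_le (hA : 1 ≤ A) (hL : ∀ x y, dist (T x) (T y) ≤ A * dist x y) (n k : ℕ)
    (x : M) : dist (T^[k * n] x) x ≤ k * A ^ (k * n - n) * dist (T^[n] x) x := by
  induction k with
  | zero => simp
  | succ k ih =>
    have hle : k * n - n ≤ k * n := Nat.sub_le _ _
    have e : (k + 1) * n - n = k * n := by rw [Nat.succ_mul]; omega
    calc dist (T^[(k + 1) * n] x) x ≤
          dist (T^[k * n] (T^[n] x)) (T^[k * n] x) + dist (T^[k * n] x) x := by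
          rw [← Function.iterate_add_apply, ← Nat.succ_mul]
          exact dist_triangle _ _ _
      _ ≤ A ^ (k * n) * dist (T^[n] x) x + k * A ^ (k * n) * dist (T^[n] x) x := by
          refine add_le_add (dist_iterate_le hA hL _ _ _) (ih.trans ?_)
          gcongr
      _ = _ := by rw [e]; push_cast; ring

/-- Very short returns of balls yield nearly periodic points whose period is comparable to the
maximal one. -/
lemma veryShortReturns_subset (hA : 1 ≤ A) (hL : ∀ x y, dist (T x) (T y) ≤ A * dist x y)
    {a ρ : ℝ} (hρ : 0 < ρ) {N : ℕ} (hN : ∀ n : ℕ, (n : ℝ) < a * |Real.log ρ| → n ≤ N) :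
    veryShortReturns T a ρ ⊆
      {c | ∃ n ≤ N, N < 2 * n ∧ dist (T^[n] c) c ≤ 2 * N * A ^ N * ρ} := by
  rintro c ⟨n, hn1, hn, y, hy, z, hz, rfl⟩
  have hnN := hN n hn
  have hk : 1 ≤ N / n := Nat.div_pos hnN hn1
  -- As k ≥ 1, the multiple satisfies N < (k + 1) n ≤ 2 k n.
  set k := N / n with hkdef
  have hkn : k * n ≤ N := Nat.div_mul_le_self N n
  have hkN : k ≤ N := Nat.div_le_self N n
  have h1 : N < (k + 1) * n := by
    have := Nat.lt_div_mul_add (a := N) (b := n) hn1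
    rw [Nat.succ_mul]; exact this
  refine ⟨k * n, hkn, by nlinarith, ?_⟩
  have hA0 : 0 ≤ A := by linarith
  have hd : dist (T^[n] c) c ≤ 2 * A ^ n * ρ := by
    have h2 : dist (T^[n] c) (T^[n] z) ≤ A ^ n * ρ :=
      (dist_iterate_le hA hL n c z).trans (mul_le_mul_of_nonneg_left
        (by rw [dist_comm]; exact (Metric.mem_ball.1 hz).le) (by positivity))
    have h3 : dist (T^[n] z) c ≤ 1 * ρ := by rw [one_mul]; exact (Metric.mem_ball.1 hy).le
    have h4 : 1 * ρ ≤ A ^ n * ρ := mul_le_mul_of_nonneg_right (one_le_pow₀ hA) hρ.le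
    linarith [dist_triangle (T^[n] c) (T^[n] z) c]
  have hnk : n ≤ k * n := Nat.le_mul_of_pos_left n hk
  calc dist (T^[k * n] c) c ≤ k * A ^ (k * n - n) * dist (T^[n] c) c :=
        dist_iterate_mul_le hA hL n k c
    _ ≤ k * A ^ (k * n - n) * (2 * A ^ n * ρ) := by gcongr
    _ = 2 * k * (A ^ (k * n - n) * A ^ n) * ρ := by ring
    _ = 2 * k * A ^ (k * n) * ρ := by rw [← pow_add, Nat.sub_add_cancel hnk]
    _ ≤ 2 * N * A ^ N * ρ := by gcongr

end

/-! ### Nearly periodic points in the base and in the tower. -/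

namespace YoungTower

section

variable {M : Type*} [MeasurableSpace M] {T : M → M} {ι : Type*}

lemma towerMeasure_apply (Y : YoungTower T ι) (hT : Measurable T) (m : Measure M) {S : Set M}
    (hS : MeasurableSet S) : Y.towerMeasure m S =
      ∑' i, ∑ j ∈ Finset.range (Y.R i), m (T^[j] ⁻¹' S ∩ Y.base i) := by
  rw [towerMeasure, Measure.sum_apply _ hS]
  congr 1
  ext i
  rw [Measure.finsetSum_apply]
  refine Finset.sum_congr rfl fun j _ => ?_
  rw [Measure.map_apply (hT.iterate j) hS, Measure.restrict_apply (hT.iterate j hS)]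

/-- The terms j = 0 already reproduce m. The set need not be measurable, which allows application to
the exceptional sets. -/
lemma measure_le_towerMeasure [Countable ι] (Y : YoungTower T ι) (hT : Measurable T)
    {m : Measure M} (hcov : ∀ᵐ x ∂m, ∃ i, x ∈ Y.base i) (S : Set M) :
    m S ≤ Y.towerMeasure m S := by
  obtain ⟨S', hSS', hS', heq⟩ := exists_measurable_superset (Y.towerMeasure m) S
  rw [← heq, Y.towerMeasure_apply hT m hS']
  calc m S ≤ m S' := measure_mono hSS'
    _ = m (S' ∩ ⋃ i, Y.base i) :=
      (measure_inter_conull (by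
        change ∀ᵐ x ∂m, x ∈ ⋃ i, Y.base i
        filter_upwards [hcov] with x hx using mem_iUnion.2 hx)).symm
    _ ≤ ∑' i, m (S' ∩ Y.base i) := by rw [inter_iUnion]; exact measure_iUnion_le _
    _ ≤ _ := ENNReal.tsum_le_tsum fun i => by
      refine le_trans (le_of_eq ?_) (Finset.single_le_sum (f := fun j => m (T^[j] ⁻¹' S' ∩ Y.base i))
        (fun _ _ => zero_le) (Finset.mem_range.2 (Y.R_pos i)))
      rfl

/-- In a column of height at most b, every level of S is sent into B by the end of the column. Each
column thus contributes at most b times the part of the preimage of B below it, and invariance sums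
these parts to m B. High columns are counted in full. -/
lemma towerMeasure_le [Countable ι] (Y : YoungTower T ι) (hT : Measurable T)
    {m : Measure M} (hpres : MeasurePreserving Y.That m m) {S B : Set M} (hS : MeasurableSet S)
    (hB : MeasurableSet B) {b : ℕ}
    (h : ∀ i, Y.R i ≤ b → ∀ x ∈ Y.base i, ∀ j < Y.R i, T^[j] x ∈ S → Y.That x ∈ B) :
    Y.towerMeasure m S ≤ b * m B + ∑' i, if b < Y.R i then Y.R i * m (Y.base i) else 0 := by
  rw [Y.towerMeasure_apply hT m hS]
  have hterm : ∀ i, ∑ j ∈ Finset.range (Y.R i), m (T^[j] ⁻¹' S ∩ Y.base i) ≤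
      b * m (Y.That ⁻¹' B ∩ Y.base i) + if b < Y.R i then Y.R i * m (Y.base i) else 0 := by
    intro i
    by_cases hb : b < Y.R i
    · rw [if_pos hb]
      refine le_add_left ?_
      calc _ ≤ ∑ j ∈ Finset.range (Y.R i), m (Y.base i) :=
            Finset.sum_le_sum fun j _ => measure_mono inter_subset_right
        _ = _ := by simp
    · rw [if_neg hb, add_zero]
      calc _ ≤ ∑ j ∈ Finset.range (Y.R i), m (Y.That ⁻¹' B ∩ Y.base i) :=
            Finset.sum_le_sum fun j hj => measure_mono fun x hx =>
              ⟨h i (not_lt.1 hb) x hx.2 j (Finset.mem_range.1 hj) hx.1, hx.2⟩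
        _ = Y.R i * m (Y.That ⁻¹' B ∩ Y.base i) := by simp
        _ ≤ _ := by gcongr; exact not_lt.1 hb
  calc _ ≤ ∑' i, (b * m (Y.That ⁻¹' B ∩ Y.base i) +
        if b < Y.R i then Y.R i * m (Y.base i) else 0) := ENNReal.tsum_le_tsum hterm
    _ = b * ∑' i, m (Y.That ⁻¹' B ∩ Y.base i) +
        ∑' i, if b < Y.R i then Y.R i * m (Y.base i) else 0 := by
        rw [ENNReal.tsum_add, ENNReal.tsum_mul_left]
    _ ≤ _ := by
        gcongr
        have hTB := Y.measurable_That hT hB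
        rw [← measure_iUnion (fun i j hij => (Y.base_disjoint hij).mono inter_subset_right
          inter_subset_right) (fun i => hTB.inter (Y.measurableSet_base i)),
          ← hpres.measure_preimage hB.nullMeasurableSet]
        exact measure_mono (iUnion_subset fun i => inter_subset_left)

/-- The mass of the high columns of the tower. -/
lemma tsum_high_columns_le [Countable ι] (Y : YoungTower T ι) {m : Measure M} {lam C : ℝ}
    (hlam : 9 < lam) (hC : 0 < C)
    (htail : ∀ k : ℕ, 1 ≤ k → m {y | k < Y.ret y} ≤ ENNReal.ofReal (C * (k : ℝ) ^ (-lam))) :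
    ∃ C' : ℝ, 0 < C' ∧ ∀ b : ℕ, 1 ≤ b →
      (∑' i, if b < Y.R i then (Y.R i : ℝ≥0∞) * m (Y.base i) else 0) ≤
        ENNReal.ofReal (C' * (b : ℝ) ^ (-((lam - 9) / 2))) := by
  have hsum : Summable fun k : ℕ => (k : ℝ) ^ (-((lam + 7) / 2)) :=
    Real.summable_nat_rpow.2 (by linarith)
  set s := ∑' k : ℕ, (k : ℝ) ^ (-((lam + 7) / 2)) with hs
  have hs0 : 0 ≤ s := tsum_nonneg fun k => by positivity
  refine ⟨C * 2 ^ lam * (s + 1), by positivity, fun b hb => ?_⟩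
  set f : ℕ → ℝ≥0∞ := fun k => if b < k then (k : ℝ≥0∞) else 0 with hf
  have h1 : (∑' i, if b < Y.R i then (Y.R i : ℝ≥0∞) * m (Y.base i) else 0) ≤
      ∫⁻ x, f (Y.ret x) ∂m := by
    calc _ = ∑' i, ∫⁻ x in Y.base i, f (Y.ret x) ∂m := by
          congr 1; ext i
          rw [setLIntegral_congr_fun (Y.measurableSet_base i)
            (g := fun _ => f (Y.R i)) (fun x hx => by simp only [Y.ret_of_mem hx]),
            setLIntegral_const, hf]
          simp only [ite_mul, zero_mul]
      _ = ∫⁻ x in ⋃ i, Y.base i, f (Y.ret x) ∂m :=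
          (lintegral_iUnion Y.measurableSet_base Y.base_disjoint _).symm
      _ ≤ _ := setLIntegral_le_lintegral _ _
  refine h1.trans ?_
  rw [← lintegral_map (f := f) (Measurable.of_discrete) Y.measurable_ret, lintegral_countable']
  have h2 : ∀ k : ℕ, f k * m.map Y.ret {k} ≤
      ENNReal.ofReal (C * 2 ^ lam * (b : ℝ) ^ (-((lam - 9) / 2)) *
        (k : ℝ) ^ (-((lam + 7) / 2))) := by
    intro k
    by_cases hk : b < k
    · rw [Measure.map_apply Y.measurable_ret (measurableSet_singleton k)]
      simp only [hf, if_pos hk]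
      have hk2 : 2 ≤ k := by omega
      have hkr : (2 : ℝ) ≤ k := by exact_mod_cast hk2
      have hle : m (Y.ret ⁻¹' {k}) ≤ m {y | k - 1 < Y.ret y} :=
        measure_mono fun y hy => by
          have : Y.ret y = k := hy
          change k - 1 < Y.ret y; omega
      have hcast : ((k - 1 : ℕ) : ℝ) = k - 1 := by push_cast [Nat.cast_sub (by omega : 1 ≤ k)]; ring
      calc (k : ℝ≥0∞) * m (Y.ret ⁻¹' {k}) ≤
            ENNReal.ofReal k * ENNReal.ofReal (C * ((k - 1 : ℕ) : ℝ) ^ (-lam)) := by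
            rw [ENNReal.ofReal_natCast]
            gcongr
            exact hle.trans (htail (k - 1) (by omega))
        _ = ENNReal.ofReal (k * (C * ((k : ℝ) - 1) ^ (-lam))) := by
            rw [← ENNReal.ofReal_mul (by positivity), hcast]
        _ ≤ _ := by
            refine ENNReal.ofReal_le_ofReal ?_
            -- The tail bound is used at k - 1 ≥ k / 2, whence the factor 2^λ.
            have e1 : ((k : ℝ) - 1) ^ (-lam) ≤ 2 ^ lam * (k : ℝ) ^ (-lam) := by
              calc ((k : ℝ) - 1) ^ (-lam) ≤ ((k : ℝ) / 2) ^ (-lam) :=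
                    Real.rpow_le_rpow_of_nonpos (by positivity) (by linarith) (by linarith)
                _ = _ := by
                    rw [Real.div_rpow (by positivity) (by norm_num), Real.rpow_neg (by norm_num : (0:ℝ) ≤ 2)]
                    field_simp
            -- The exponent 1 - λ is split into the decay wanted in b and a summable remainder.
            have e2 : (k : ℝ) * (k : ℝ) ^ (-lam) =
                (k : ℝ) ^ (-((lam - 9) / 2)) * (k : ℝ) ^ (-((lam + 7) / 2)) := by
              rw [← Real.rpow_add (by positivity), ← Real.rpow_one_add' (by positivity) (by linarith)]
              congr 1; ring
            have e3 : (k : ℝ) ^ (-((lam - 9) / 2)) ≤ (b : ℝ) ^ (-((lam - 9) / 2)) :=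
              Real.rpow_le_rpow_of_nonpos (by exact_mod_cast hb) (by exact_mod_cast hk.le)
                (by linarith)
            calc (k : ℝ) * (C * ((k : ℝ) - 1) ^ (-lam)) ≤
                  (k : ℝ) * (C * (2 ^ lam * (k : ℝ) ^ (-lam))) := by gcongr
              _ = C * 2 ^ lam * ((k : ℝ) * (k : ℝ) ^ (-lam)) := by ring
              _ = C * 2 ^ lam * (k : ℝ) ^ (-((lam - 9) / 2)) * (k : ℝ) ^ (-((lam + 7) / 2)) := by
                  rw [e2]; ring
              _ ≤ _ := by gcongr
    · simp [hf, hk]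
  refine (ENNReal.tsum_le_tsum h2).trans ?_
  rw [← ENNReal.ofReal_tsum_of_nonneg (fun k => by positivity) (hsum.mul_left _), tsum_mul_left,
    ← hs]
  refine ENNReal.ofReal_le_ofReal ?_
  have : 0 ≤ C * 2 ^ lam * (b : ℝ) ^ (-((lam - 9) / 2)) := by positivity
  nlinarith

/-- The time that the first `q` returns take. -/
noncomputable def retSum (Y : YoungTower T ι) (q : ℕ) (x : M) : ℕ :=
  ∑ k ∈ Finset.range q, Y.ret (Y.That^[k] x)

lemma measurable_retSum [Countable ι] (Y : YoungTower T ι) (hT : Measurable T) (q : ℕ) :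
    Measurable (Y.retSum q) :=
  Finset.measurable_fun_sum _ fun k _ => Y.measurable_ret.comp ((Y.measurable_That hT).iterate k)

lemma iterate_That_eq (Y : YoungTower T ι) (q : ℕ) (x : M) :
    Y.That^[q] x = T^[Y.retSum q x] x := by
  induction q with
  | zero => simp [retSum]
  | succ q ih =>
    rw [Function.iterate_succ_apply', That, retSum, Finset.sum_range_succ, add_comm,
      Function.iterate_add_apply, ← retSum, ← ih]

lemma SameCyl.retSum_eq {Y : YoungTower T ι} {q : ℕ} {x y : M} (h : Y.SameCyl q x y) :
    Y.retSum q x = Y.retSum q y := by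
  refine Finset.sum_congr rfl fun k hk => ?_
  obtain ⟨i, hi, hi'⟩ := h k (Finset.mem_range.1 hk)
  rw [Y.ret_of_mem hi, Y.ret_of_mem hi']

lemma le_retSum (Y : YoungTower T ι) {q : ℕ} {x : M} (h : Y.SameCyl q x x) :
    q ≤ Y.retSum q x := by
  calc q = ∑ k ∈ Finset.range q, 1 := by simp
    _ ≤ _ := Finset.sum_le_sum fun k hk => by
      obtain ⟨i, hi, -⟩ := h k (Finset.mem_range.1 hk)
      rw [Y.ret_of_mem hi]; exact Y.R_pos i

/-- The first return to the base after time `n`, when all the return times are at most `b`. -/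
lemma exists_retSum (Y : YoungTower T ι) {n b : ℕ} (hn : 1 ≤ n) {x : M} (h : Y.SameCyl n x x)
    (hb : ∀ k ≤ n, Y.ret (Y.That^[k] x) ≤ b) :
    ∃ q ≤ n, n ≤ Y.retSum q x ∧ Y.retSum q x ≤ n + b ∧ n ≤ q * b := by
  classical
  -- Take the least such q. It is at most n because every return takes at least one step, and
  -- minimality means that only the last return, of length at most b, can overshoot n.
  have hex : ∃ q, n ≤ Y.retSum q x := ⟨n, Y.le_retSum h⟩
  have hqn : Nat.find hex ≤ n := Nat.find_min' hex (Y.le_retSum h)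
  have hq := Nat.find_spec hex
  have hmin := fun k => Nat.find_min (m := k) hex
  generalize Nat.find hex = q at hqn hq hmin
  refine ⟨q, hqn, hq, ?_, ?_⟩
  · cases q with
    | zero => simp [retSum] at hq; omega
    | succ q =>
      have h1 := hmin q (Nat.lt_succ_self q)
      have h2 := hb q (by omega)
      rw [retSum, Finset.sum_range_succ, ← retSum]
      omega
  · refine hq.trans ?_
    calc Y.retSum q x ≤ ∑ k ∈ Finset.range q, b :=
          Finset.sum_le_sum fun k hk => hb k ((Finset.mem_range.1 hk).le.trans hqn)
      _ = q * b := by simp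

end

variable {M : Type*} [MetricSpace M] [MeasurableSpace M] {T : M → M} {ι : Type*}

/-- The mass in the base of the nearly periodic points. -/
lemma IsExpanding.exists_nearlyPeriodic_base [CompactSpace M] [BorelSpace M] [Countable ι]
    {Y : YoungTower T ι} {J : M → ℝ} {C₀ α : ℝ} (hY : Y.IsExpanding J C₀ α) {m : Measure M}
    [IsFiniteMeasure m] {κ : Kernel M M} (hm : Y.IsSRB m κ) {A : ℝ} (hA : 1 ≤ A)
    (hL : ∀ x y, dist (T x) (T y) ≤ A * dist x y) {N b : ℕ} {r σ : ℝ} {τ : ℝ≥0∞} {Ex : Set M}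
    (hN : 1 ≤ N)
    (hEx : ∀ᵐ x ∂m, ∀ c, c ∉ Ex → Y.nhat x (Metric.ball c σ) ≤ τ)
    (hclose : ∀ q : ℕ, N ≤ 2 * (q * b) → A ^ b * (2 * r + C₀ * α ^ q) < σ) :
    ∃ B : Set M, MeasurableSet B ∧
      (∀ x, (∃ n ≤ N, N < 2 * n ∧ dist (T^[n] x) x ≤ r) → x ∈ B) ∧
      m B ≤ (N + 1) * m {y | b < Y.ret y} + (N + 1) * m Ex +
        (N + 1) * ((N + 1) * (sqDist C₀ α ^ 2 * τ * m univ)) := by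
  have hTm := hY.emb.measurable
  have hpres := hm.measurePreserving hTm
  have hcont : Continuous T :=
    (LipschitzWith.of_dist_le_mul (K := ⟨A, by linarith⟩) hL).continuous
  -- The exceptional set need not be measurable, so a measurable hull of equal mass is used; `E₁`
  -- absorbs the leaves where the ball estimate fails.
  set E₀ := toMeasurable m Ex with hE₀
  obtain ⟨E₁, hE₁, hE₁m, hE₁0⟩ := exists_measurable_superset_of_null hEx
  set N₀ : Set M := {x | x ∈ Y.Λ ∧ ∀ n, Y.SameCyl n x x}ᶜ with hN₀
  have hN₀m : MeasurableSet N₀ := by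
    refine (Y.measurableSet_Λ.inter (MeasurableSet.iInter (ι := ℕ) fun n =>
      Y.measurableSet_sameCyl_self hTm n)).compl.congr ?_
    ext x; simp [hN₀]
  have hN₀0 : m N₀ = 0 := by
    filter_upwards [hm.ae_mem, hY.ae_sameCyl hm] with x h1 h2 using ⟨h1, h2⟩
  have hIm := fun k => (Y.measurable_That hTm).iterate k
  set G : Set M := E₀ ∪ E₁ with hG
  have hGm : MeasurableSet G := (measurableSet_toMeasurable m Ex).union hE₁m
  have hmG : m G ≤ m Ex := by
    refine (measure_union_le _ _).trans ?_
    rw [hE₁0, add_zero, measure_toMeasurable]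
  -- The good points of near-period n whose q-th return is the first one after time n; by the choice
  -- of q its delay is at most b and q is large.
  let W : ℕ → ℕ → Set M := fun n q => {x | (x ∈ Y.Λ ∧ Y.SameCyl q x x) ∧ dist (T^[n] x) x ≤ r ∧
    (n ≤ Y.retSum q x ∧ Y.retSum q x ≤ n + b) ∧ N ≤ 2 * (q * b) ∧ Y.That^[q] x ∈ Gᶜ}
  have hWm : ∀ n q, MeasurableSet (W n q) := by
    intro n q
    have h1 : MeasurableSet {x | x ∈ Y.Λ ∧ Y.SameCyl q x x} :=
      Y.measurableSet_Λ.inter (Y.measurableSet_sameCyl_self hTm q)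
    have h2 : MeasurableSet {x | dist (T^[n] x) x ≤ r} :=
      (isClosed_le ((hcont.iterate n).dist continuous_id) continuous_const).measurableSet
    have h3 : MeasurableSet {x | n ≤ Y.retSum q x ∧ Y.retSum q x ≤ n + b} :=
      Y.measurable_retSum hTm q (measurableSet_Icc (a := n) (b := n + b))
    exact h1.inter (h2.inter (h3.inter ((MeasurableSet.const _).inter (hIm q hGm.compl))))
  have hWmeas : ∀ n q, m (W n q) ≤ sqDist C₀ α ^ 2 * τ * m univ := by
    intro n q
    refine hY.measure_le_of_close hm (σ := σ) (hWm n q) (fun x hx => hx.1.2) ?_ ?_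
    · intro x hx
      have h1 : Y.That^[q] x ∉ E₁ := fun h => hx.2.2.2.2 (Or.inr h)
      have h2 : Y.That^[q] x ∉ Ex := fun h =>
        hx.2.2.2.2 (Or.inl (subset_toMeasurable m Ex h))
      by_contra hlt
      exact h1 (hE₁ fun h => hlt (h _ h2))
    · intro x hx y hy hyx hxy
      obtain ⟨⟨hxΛ, -⟩, hxr, ⟨hx1, hx2⟩, hNq, -⟩ := hx
      obtain ⟨⟨hyΛ, -⟩, hyr, -, -, -⟩ := hy
      refine lt_of_le_of_lt ?_ (hclose q hNq)
      have hq : 1 ≤ q := by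
        rcases Nat.eq_zero_or_pos q with h0 | h0
        · rw [h0] at hNq; omega
        · exact h0
      -- Points of a common q-cylinder share all return times, so their q-th returns are reached
      -- from time n by the same power of T, which is at most b.
      have hret : ∀ z, Y.retSum q z = Y.retSum q x →
          Y.That^[q] z = T^[Y.retSum q x - n] (T^[n] z) := by
        intro z hz
        rw [Y.iterate_That_eq, hz, ← Function.iterate_add_apply, Nat.sub_add_cancel hx1]
      have hd := hY.contraction q hq x hxΛ y hyΛ hyx hxy
      rw [hret x rfl, hret y hxy.retSum_eq.symm]
      have h1 : dist (T^[n] y) (T^[n] x) ≤ 2 * r + C₀ * α ^ q := by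
        have := dist_triangle4 (T^[n] y) y x (T^[n] x)
        rw [dist_comm x (T^[n] x), dist_comm y x] at this
        linarith
      calc _ ≤ A ^ (Y.retSum q x - n) * dist (T^[n] y) (T^[n] x) := dist_iterate_le hA hL _ _ _
        _ ≤ A ^ b * dist (T^[n] y) (T^[n] x) := by gcongr; omega
        _ ≤ _ := by gcongr
  refine ⟨N₀ ∪ (⋃ k ∈ Finset.range (N + 1), Y.That^[k] ⁻¹' {y | b < Y.ret y}) ∪
    (⋃ k ∈ Finset.range (N + 1), Y.That^[k] ⁻¹' G) ∪
    ⋃ n ∈ Finset.range (N + 1), ⋃ q ∈ Finset.range (N + 1), W n q, ?_, ?_, ?_⟩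
  · refine ((hN₀m.union ?_).union ?_).union ?_
    · exact Finset.measurableSet_biUnion _ fun k _ => hIm k (Y.measurable_ret measurableSet_Ioi)
    · exact Finset.measurableSet_biUnion _ fun k _ => hIm k hGm
    · exact Finset.measurableSet_biUnion _ fun n _ => Finset.measurableSet_biUnion _ fun q _ =>
        hWm n q
  · rintro x ⟨n, hnN, hNn, hnr⟩
    by_contra hx
    simp only [mem_union, mem_iUnion, Finset.mem_range, not_or, not_exists, mem_preimage,
      mem_ofPred_eq, not_lt, Nat.lt_succ_iff] at hx
    obtain ⟨⟨⟨hx0, hx1⟩, hx2⟩, hx3⟩ := hx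
    obtain ⟨hxΛ, hxc⟩ := not_not.1 hx0
    obtain ⟨q, hqn, h1, h2, h3⟩ := Y.exists_retSum (b := b) (by omega : 1 ≤ n) (hxc n)
      fun k hk => hx1 k (hk.trans hnN)
    exact hx3 n hnN q (hqn.trans hnN) ⟨⟨hxΛ, hxc q⟩, hnr, ⟨h1, h2⟩, by omega,
      hx2 q (hqn.trans hnN)⟩
  · have hsum1 : ∀ (F : ℕ → Set M) (v : ℝ≥0∞), (∀ k, m (F k) ≤ v) →
        m (⋃ k ∈ Finset.range (N + 1), F k) ≤ (N + 1) * v := by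
      intro F v hF
      calc _ ≤ ∑ k ∈ Finset.range (N + 1), m (F k) := measure_biUnion_finset_le _ _
        _ ≤ ∑ k ∈ Finset.range (N + 1), v := Finset.sum_le_sum fun k _ => hF k
        _ = _ := by simp
    refine (measure_union_le _ _).trans (add_le_add ((measure_union_le _ _).trans
      (add_le_add ((measure_union_le _ _).trans ?_) ?_)) ?_)
    · rw [hN₀0, zero_add]
      exact hsum1 _ _ fun k => ((hpres.iterate k).measure_preimage
        (Y.measurable_ret measurableSet_Ioi).nullMeasurableSet).le
    · exact hsum1 _ _ fun k => ((hpres.iterate k).measure_preimage hGm.nullMeasurableSet).le.trans hmG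
    · exact hsum1 _ _ fun n => hsum1 _ _ fun q => hWmeas n q

/-- The mass in the tower of the nearly periodic points. -/
lemma IsExpanding.towerMeasure_nearlyPeriodic_le [CompactSpace M] [BorelSpace M] [Countable ι]
    {Y : YoungTower T ι} {J : M → ℝ} {C₀ α : ℝ} (hY : Y.IsExpanding J C₀ α) {m : Measure M}
    [IsFiniteMeasure m] {κ : Kernel M M} (hm : Y.IsSRB m κ) {A : ℝ} (hA : 1 ≤ A)
    (hL : ∀ x y, dist (T x) (T y) ≤ A * dist x y) {N b : ℕ} {r σ : ℝ} {τ : ℝ≥0∞} {Ex : Set M}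
    (hN : 1 ≤ N)
    (hEx : ∀ᵐ x ∂m, ∀ c, c ∉ Ex → Y.nhat x (Metric.ball c σ) ≤ τ)
    (hclose : ∀ q : ℕ, N ≤ 2 * (q * b) → A ^ b * (2 * (A ^ b * r) + C₀ * α ^ q) < σ) :
    Y.towerMeasure m {c | ∃ n ≤ N, N < 2 * n ∧ dist (T^[n] c) c ≤ r} ≤
      b * ((N + 1) * m {y | b < Y.ret y} + (N + 1) * m Ex +
        (N + 1) * ((N + 1) * (sqDist C₀ α ^ 2 * τ * m univ))) +
      ∑' i, if b < Y.R i then Y.R i * m (Y.base i) else 0 := by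
  obtain ⟨B, hBm, hB, hmB⟩ := hY.exists_nearlyPeriodic_base hm hA hL hN hEx hclose
  have hTm := hY.emb.measurable
  have hcont : Continuous T :=
    (LipschitzWith.of_dist_le_mul (K := ⟨A, by linarith⟩) hL).continuous
  have hSm : MeasurableSet {c | ∃ n ≤ N, N < 2 * n ∧ dist (T^[n] c) c ≤ r} := by
    have : {c | ∃ n ≤ N, N < 2 * n ∧ dist (T^[n] c) c ≤ r} =
        ⋃ n ∈ {n | n ≤ N ∧ N < 2 * n}, {c | dist (T^[n] c) c ≤ r} := by
      ext c; simp [and_assoc]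
    rw [this]
    exact MeasurableSet.biUnion (to_countable _) fun n _ =>
      (isClosed_le ((hcont.iterate n).dist continuous_id) continuous_const).measurableSet
  refine (Y.towerMeasure_le hTm (hm.measurePreserving hTm) hSm hBm (b := b) ?_).trans
    (by gcongr)
  rintro i hib x hx j hj ⟨n, hn, hNn, hd⟩
  refine hB _ ⟨n, hn, hNn, ?_⟩
  have e : Y.That x = T^[Y.R i - j] (T^[j] x) := by
    rw [Y.That_of_mem hx, ← Function.iterate_add_apply, Nat.sub_add_cancel hj.le]
  -- T^n commutes with the climb to the top of the column, so near-periodicity survives with r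
  -- replaced by A^b r.
  rw [e, ← Function.iterate_add_apply, add_comm n, Function.iterate_add_apply]
  calc _ ≤ A ^ (Y.R i - j) * dist (T^[n] (T^[j] x)) (T^[j] x) := dist_iterate_le hA hL _ _ _
    _ ≤ A ^ b * r := by
      gcongr
      omega

end YoungTower

/-! ### Choice of scales and size of the errors. -/

lemma exists_scale_close {D C₀ α a : ℝ} (hD : 0 < D) (hC₀ : 0 < C₀) (hα : α ∈ Ioo (0 : ℝ) 1)
    (ha : 0 < a) (haD : D * a ≤ 1 / 4) : ∃ δ : ℝ, 0 < δ ∧ ∀ᶠ t : ℝ in atTop, ∀ N b q : ℕ,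
      N = ⌊a * t ^ 2⌋₊ → b = ⌊δ * t⌋₊ → N ≤ 2 * (q * b) →
      Real.exp D ^ b * (2 * (Real.exp D ^ b * (2 * N * Real.exp D ^ N * Real.exp (-t ^ 2))) +
        C₀ * α ^ q) < Real.exp (-t) / 3 := by
  set β := -Real.log α with hβ
  have hβ0 : 0 < β := neg_pos.2 (Real.log_neg hα.1 hα.2)
  have hαexp : α = Real.exp (-β) := by rw [hβ, neg_neg, Real.exp_log hα.1]
  -- If N ≤ 2 q b then q is at least about a t / (4 δ). This δ makes α^q ≤ e^(-(D+2)t), which beats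
  -- A^b ≤ e^(Dt) by e^(-2t).
  set δ := min 1 (β * a / (4 * (D + 2))) with hδ
  have hδ0 : 0 < δ := lt_min one_pos (by positivity)
  have hδ1 : δ ≤ 1 := min_le_left _ _
  have hδ2 : δ * (4 * (D + 2)) ≤ β * a := by
    rw [← le_div_iff₀ (by positivity)]; exact min_le_right _ _
  refine ⟨δ, hδ0, ?_⟩
  have h1 : ∀ᶠ t : ℝ in atTop, C₀ * Real.exp (-t) < 1 / 6 := by
    have : Tendsto (fun t : ℝ => C₀ * Real.exp (-t)) atTop (𝓝 (C₀ * 0)) :=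
      Real.tendsto_exp_neg_atTop_nhds_zero.const_mul C₀
    rw [mul_zero] at this
    exact this.eventually_lt_const (by norm_num)
  have h2 : ∀ᶠ t : ℝ in atTop, 4 * a * (t ^ 2 * Real.exp (-t)) < 1 / 6 := by
    have : Tendsto (fun t : ℝ => 4 * a * (t ^ 2 * Real.exp (-t))) atTop (𝓝 (4 * a * 0)) :=
      (Real.tendsto_pow_mul_exp_neg_atTop_nhds_zero 2).const_mul _
    rw [mul_zero] at this
    exact this.eventually_lt_const (by norm_num)
  filter_upwards [h1, h2, eventually_ge_atTop 1, eventually_ge_atTop (2 / a),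
    eventually_ge_atTop (4 * (2 * D + 2) / 3)] with t ht1 ht2 ht ht3 ht4 N b q hN hb hq
  have ht0 : 0 < t := by linarith
  have hNle : (N : ℝ) ≤ a * t ^ 2 := hN ▸ Nat.floor_le (by positivity)
  have hNge : a * t ^ 2 / 2 ≤ N := by
    have h3 : a * t ^ 2 < N + 1 := hN ▸ Nat.lt_floor_add_one _
    have h4 : 2 ≤ a * t := by rwa [div_le_iff₀' ha] at ht3
    nlinarith
  have hble : (b : ℝ) ≤ δ * t := hb ▸ Nat.floor_le (by positivity)
  have hblet : (b : ℝ) ≤ t := hble.trans (by nlinarith)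
  have hqb : a * t ^ 2 / 4 ≤ q * (δ * t) := by
    have h3 : (N : ℝ) ≤ 2 * (q * b) := by exact_mod_cast hq
    have h4 : (q : ℝ) * b ≤ q * (δ * t) := by gcongr
    linarith
  have hqt : (D + 2) * t ≤ β * q := by
    have h3 : a * t / 4 ≤ q * δ := by
      have : a * t / 4 * t ≤ q * δ * t := by nlinarith
      exact le_of_mul_le_mul_right this ht0
    have h4 : δ * ((D + 2) * t) ≤ δ * (β * q) := by nlinarith
    exact le_of_mul_le_mul_left h4 hδ0
  have hDt : Real.exp D ^ b ≤ Real.exp (D * t) := by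
    rw [← Real.exp_nat_mul]
    exact Real.exp_le_exp.2 (by nlinarith)
  have hDN : Real.exp D ^ N ≤ Real.exp (t ^ 2 / 4) := by
    rw [← Real.exp_nat_mul]
    refine Real.exp_le_exp.2 ?_
    have : (N : ℝ) * D ≤ a * t ^ 2 * D := by gcongr
    nlinarith [sq_nonneg t]
  have hαq : α ^ q ≤ Real.exp (-((D + 2) * t)) := by
    rw [hαexp, ← Real.exp_nat_mul]
    exact Real.exp_le_exp.2 (by linarith)
  have hA : Real.exp D ^ b * (C₀ * α ^ q) ≤ C₀ * Real.exp (-t) * Real.exp (-t) := by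
    calc _ ≤ Real.exp (D * t) * (C₀ * Real.exp (-((D + 2) * t))) := by
          have := pow_nonneg hα.1.le q
          gcongr
      _ = C₀ * (Real.exp (D * t) * Real.exp (-((D + 2) * t))) := by ring
      _ = C₀ * (Real.exp (-t) * Real.exp (-t)) := by
          rw [← Real.exp_add, ← Real.exp_add]; congr 2; ring
      _ = _ := by ring
  -- Here D a ≤ 1/4 enters: A^N ≤ e^(t²/4), so e^(-t²) leaves e^(-3t²/4) to absorb A^(2b) and a
  -- further e^(-2t).
  have hB : Real.exp D ^ b * (2 * (Real.exp D ^ b *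
      (2 * N * Real.exp D ^ N * Real.exp (-t ^ 2)))) ≤
      4 * a * (t ^ 2 * Real.exp (-t)) * Real.exp (-t) := by
    calc _ ≤ Real.exp (D * t) * (2 * (Real.exp (D * t) *
          (2 * (a * t ^ 2) * Real.exp (t ^ 2 / 4) * Real.exp (-t ^ 2)))) := by gcongr
      _ = 4 * a * t ^ 2 * (Real.exp (D * t) * Real.exp (D * t) * Real.exp (t ^ 2 / 4) *
          Real.exp (-t ^ 2)) := by ring
      _ ≤ 4 * a * t ^ 2 * (Real.exp (-t) * Real.exp (-t)) := by
          refine mul_le_mul_of_nonneg_left ?_ (by positivity)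
          rw [← Real.exp_add, ← Real.exp_add, ← Real.exp_add, ← Real.exp_add]
          refine Real.exp_le_exp.2 ?_
          have : 4 * (2 * D + 2) ≤ 3 * t := by linarith [(div_le_iff₀ (by norm_num : (0:ℝ) < 3)).1 ht4]
          nlinarith
      _ = _ := by ring
  have hpos := Real.exp_pos (-t)
  rw [mul_add]
  nlinarith

/-- Since b is of order t and N at most of order t², the first two terms are of order t^(3-λ) and
t^(3-λ/2), the exponential term at most t^5 e^(-s t), and the last one has the asserted order; λ > 9
makes each of them small enough. -/
lemma exists_error_bound {lam a δ C C₂ C' Q s : ℝ} (hlam : 9 < lam) (ha : 0 < a) (hδ : 0 < δ)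
    (hC : 0 < C) (hC₂ : 0 < C₂) (hC' : 0 < C') (hQ : 0 ≤ Q) (hs : 0 < s) :
    ∃ C₁₀ : ℝ, 0 < C₁₀ ∧ ∀ᶠ t : ℝ in atTop, ∀ N b : ℕ, N = ⌊a * t ^ 2⌋₊ → b = ⌊δ * t⌋₊ →
      b * ((N + 1) * (C * (b : ℝ) ^ (-lam)) + (N + 1) * (C₂ * t ^ (-lam / 2)) +
        (N + 1) * ((N + 1) * (Q * Real.exp (-s * t)))) + C' * (b : ℝ) ^ (-((lam - 9) / 2)) ≤
      C₁₀ * t ^ (-((lam - 9) / 2)) := by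
  refine ⟨δ * (a + 1) * C * (δ / 2) ^ (-lam) + δ * (a + 1) * C₂ + δ * (a + 1) ^ 2 * Q +
    C' * (δ / 2) ^ (-((lam - 9) / 2)), by positivity, ?_⟩
  have h1 : ∀ᶠ t : ℝ in atTop, t ^ (5 + (lam - 9) / 2) * Real.exp (-s * t) < 1 :=
    (tendsto_rpow_mul_exp_neg_mul_atTop_nhds_zero _ s hs).eventually_lt_const one_pos
  filter_upwards [h1, eventually_ge_atTop 1, eventually_ge_atTop (2 / δ)]
    with t ht1 ht ht3 N b hN hb
  have ht0 : 0 < t := by linarith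
  have hNle : (N : ℝ) + 1 ≤ (a + 1) * t ^ 2 := by
    have : (N : ℝ) ≤ a * t ^ 2 := hN ▸ Nat.floor_le (by positivity)
    nlinarith
  have hble : (b : ℝ) ≤ δ * t := hb ▸ Nat.floor_le (by positivity)
  have hbge : δ / 2 * t ≤ b := by
    have h3 : δ * t < b + 1 := hb ▸ Nat.lt_floor_add_one _
    have h4 : 2 ≤ δ * t := by rwa [div_le_iff₀' hδ] at ht3
    nlinarith
  set x := t ^ (-((lam - 9) / 2)) with hx
  have hx0 : 0 < x := by positivity
  have hpow : ∀ e : ℝ, e ≤ 0 → (b : ℝ) ^ e ≤ (δ / 2) ^ e * t ^ e := fun e he => by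
    rw [← Real.mul_rpow (by positivity) ht0.le]
    exact Real.rpow_le_rpow_of_nonpos (by positivity) hbge he
  have e1 : t ^ 3 * t ^ (-lam) ≤ x := by
    rw [← Real.rpow_natCast, ← Real.rpow_add ht0]
    exact Real.rpow_le_rpow_of_exponent_le ht (by push_cast; linarith)
  have e2 : t ^ 3 * t ^ (-lam / 2) ≤ x := by
    rw [← Real.rpow_natCast, ← Real.rpow_add ht0]
    exact Real.rpow_le_rpow_of_exponent_le ht (by push_cast; linarith)
  have e3 : t ^ 5 * Real.exp (-s * t) ≤ x := by
    rw [Real.rpow_add ht0] at ht1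
    have h5 : t ^ (5 : ℝ) = t ^ 5 := by exact_mod_cast Real.rpow_natCast t 5
    rw [hx, Real.rpow_neg ht0.le, ← one_div, le_div_iff₀ (by positivity), ← h5]
    linarith
  have t1 : b * ((N + 1) * (C * (b : ℝ) ^ (-lam))) ≤ δ * (a + 1) * C * (δ / 2) ^ (-lam) * x := by
    calc _ ≤ (δ * t) * (((a + 1) * t ^ 2) * (C * ((δ / 2) ^ (-lam) * t ^ (-lam)))) := by
          gcongr; exact hpow _ (by linarith)
      _ = δ * (a + 1) * C * (δ / 2) ^ (-lam) * (t ^ 3 * t ^ (-lam)) := by ring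
      _ ≤ _ := by gcongr
  have t2 : b * ((N + 1) * (C₂ * t ^ (-lam / 2))) ≤ δ * (a + 1) * C₂ * x := by
    calc _ ≤ (δ * t) * (((a + 1) * t ^ 2) * (C₂ * t ^ (-lam / 2))) := by gcongr
      _ = δ * (a + 1) * C₂ * (t ^ 3 * t ^ (-lam / 2)) := by ring
      _ ≤ _ := by gcongr
  have t3 : b * ((N + 1) * ((N + 1) * (Q * Real.exp (-s * t)))) ≤ δ * (a + 1) ^ 2 * Q * x := by
    calc _ ≤ (δ * t) * (((a + 1) * t ^ 2) * (((a + 1) * t ^ 2) * (Q * Real.exp (-s * t)))) := by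
          gcongr
      _ = δ * (a + 1) ^ 2 * Q * (t ^ 5 * Real.exp (-s * t)) := by ring
      _ ≤ _ := by gcongr
  have t4 : C' * (b : ℝ) ^ (-((lam - 9) / 2)) ≤ C' * (δ / 2) ^ (-((lam - 9) / 2)) * x := by
    rw [mul_assoc]
    gcongr
    exact hpow _ (by linarith)
  linarith

/-! ### Assembly. -/

namespace YoungTower

section

variable {M : Type*} [MeasurableSpace M] {T : M → M} {ι : Type*}

lemma IsSRB.ae_mem_base [Countable ι] {Y : YoungTower T ι} {m : Measure M} {κ : Kernel M M}
    (hm : Y.IsSRB m κ) : ∀ᵐ x ∂m, ∃ i, x ∈ Y.base i := by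
  have hU : MeasurableSet (⋃ i, Y.base i) := MeasurableSet.iUnion Y.measurableSet_base
  have : m (⋃ i, Y.base i)ᶜ = 0 := by
    rw [hm.disintegration _ hU.compl, lintegral_eq_zero_iff (κ.measurable_coe hU.compl)]
    filter_upwards [hm.absolutelyContinuous, hm.ae_mem] with x hx hxΛ
    refine hx (measure_mono_null (t := (Y.unstable x ∩ Y.Λ)ᶜ ∪ (Y.Λ \ ⋃ i, Y.base i)) ?_
      (measure_union_null (Y.mhat_leaf x hxΛ) (Y.mhat_cover x hxΛ)))
    intro y hy
    by_cases hyΛ : y ∈ Y.Λ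
    · exact Or.inr ⟨hyΛ, hy⟩
    · exact Or.inl fun h => hyΛ h.2
  filter_upwards [measure_eq_zero_iff_ae_notMem.1 this] with x hx
  exact mem_iUnion.1 (not_not.1 hx)

end

/-- Absolute continuity of the holonomy transports the positive mass of one leaf to a uniform lower
bound for all leaves; backward contraction is only needed at time 0. -/
lemma Regular.exists_isExpanding {M : Type*} [MetricSpace M] [MeasurableSpace M] {T : M → M}
    {ι : Type*} [Countable ι] {Y : YoungTower T ι} (hT : MeasurableEmbedding T) (h : Y.Regular)
    (hne : ∃ x ∈ Y.Λ, Y.mhat x univ ≠ 0) :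
    ∃ (J : M → ℝ) (C₀ α : ℝ), Y.IsExpanding J C₀ α ∧
      ∃ c : ℝ≥0∞, c ≠ 0 ∧ ∀ x ∈ Y.Λ, c ≤ Y.mhat x univ := by
  obtain ⟨C₀, hC₀, α, hα, J, hJ, hdist, hb, hc, hd, -⟩ := h
  obtain ⟨x₀, hx₀, hx₀0⟩ := hne
  have hlow : ∀ x ∈ Y.Λ, ENNReal.ofReal (Real.exp (-C₀)) * Y.mhat x₀ univ ≤ Y.mhat x univ :=
    fun x hx => Y.exists_le_mhat hT hJ hC₀ hα hdist hc hd hx₀ hx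
  have hpos : ENNReal.ofReal (Real.exp (-C₀)) * Y.mhat x₀ univ ≠ 0 :=
    mul_ne_zero (by simpa using Real.exp_pos _) hx₀0
  refine ⟨J, C₀, α, ⟨hT, hJ, hC₀, hα, hdist, ?_, ?_⟩, _, hpos, hlow⟩
  · intro n hn x hx y hy hxy hs
    have hsep := hs.le_sepTime
    have h1 := hb x hx y hy (le_trans (by exact_mod_cast hn) hsep)
      (Y.unstable_eq x hx y hy hxy).symm 0
      (lt_of_lt_of_le (by exact_mod_cast hn) hsep)
    refine h1.trans ?_
    gcongr
    refine powENat_le_pow hα ?_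
    simpa using hsep
  · exact fun x hx h0 => hpos (le_antisymm (h0 ▸ hlow x hx) zero_le)

/-- The measure of the points with very short returns, for a Lipschitz map. -/
theorem measure_veryShortReturns_le {M : Type*} [MetricSpace M] [CompactSpace M]
    [MeasurableSpace M] [BorelSpace M] {T : M → M} (hT : MeasurableEmbedding T) {A : ℝ} (hA : 0 ≤ A)
    (hL : ∀ x y, dist (T x) (T y) ≤ A * dist x y)
    {ι : Type*} [Countable ι] (Y : YoungTower T ι)
    {m : Measure M} {κ : Kernel M M} (hm : Y.IsSRB m κ)
    (hμ : IsProbabilityMeasure (Y.towerMeasure m))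
    {lam : ℝ} (hlam : 9 < lam)
    (hB1 : Y.Regular)
    (hB2 : Y.PolynomialTail lam)
    (hB3 : GeometricallyRegular m κ (Y.towerMeasure m) lam) :
    ∃ C₁₀ : ℝ, 0 < C₁₀ ∧ ∃ ρ₀ : ℝ, 0 < ρ₀ ∧ ∀ ρ : ℝ, 0 < ρ → ρ < ρ₀ →
      Y.towerMeasure m (veryShortReturns T (4 * Real.log A)⁻¹ ρ) ≤
        ENNReal.ofReal (C₁₀ / |Real.log ρ| ^ ((lam - 9) / 4)) := by
  -- For log A ≤ 0 (with the inverse of 0 being 0) the range of admissible n is empty.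
  rcases le_or_gt (Real.log A) 0 with hA0 | hD
  · refine ⟨1, one_pos, 1, one_pos, fun ρ _ _ => ?_⟩
    have : veryShortReturns T (4 * Real.log A)⁻¹ ρ = ∅ := by
      ext c
      simp only [mem_empty_iff_false, iff_false]
      rintro ⟨n, hn1, hn, -⟩
      have h1 : (4 * Real.log A)⁻¹ ≤ 0 := inv_nonpos.2 (by linarith)
      have h2 : (1 : ℝ) ≤ n := by exact_mod_cast hn1
      nlinarith [abs_nonneg (Real.log ρ)]
    rw [this, measure_empty]
    exact zero_le
  have hcov := hm.ae_mem_base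
  have hmμ := fun S => Y.measure_le_towerMeasure hT.measurable hcov S
  have hm1 : m univ ≤ 1 := (hmμ univ).trans prob_le_one
  have hfin : IsFiniteMeasure m := ⟨hm1.trans_lt ENNReal.one_lt_top⟩
  have hm0 : m ≠ 0 := by
    rintro rfl
    have h1 : Y.towerMeasure (0 : Measure M) univ = 1 := measure_univ
    rw [Y.towerMeasure_apply hT.measurable _ MeasurableSet.univ] at h1
    simp at h1
  have hne : ∃ x ∈ Y.Λ, Y.mhat x univ ≠ 0 := by
    have : NeBot (ae m) := ae_neBot.2 hm0
    obtain ⟨x, hx, hac⟩ := (hm.ae_mem.and hm.absolutelyContinuous).exists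
    refine ⟨x, hx, fun h0 => ?_⟩
    have hp := hm.prob x hx
    have h1 : κ x univ = 0 := hac h0
    simp at h1
  obtain ⟨J, C₀, α, hY, c, hc0, hc⟩ := hB1.exists_isExpanding hT hne
  obtain ⟨C, hC, htail⟩ := hY.measure_tail hm hB2 hc0 hc
  obtain ⟨C', hC', hhigh⟩ := Y.tsum_high_columns_le hlam hC htail
  obtain ⟨s, hs, C₂, hC₂, ρ₁, hρ₁, Ex, hExμ, hExκ⟩ := hB3
  set D := Real.log A with hDdef
  set a := (4 * D)⁻¹ with hadef
  have ha : 0 < a := by positivity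
  have hApos : 0 < A := hA.lt_of_ne fun h => by simp [hDdef, ← h] at hD
  have hAexp : A = Real.exp D := (Real.exp_log hApos).symm
  have hA1 : 1 ≤ A := hAexp ▸ Real.one_le_exp hD.le
  obtain ⟨δ, hδ, hscale⟩ := exists_scale_close hD hY.pos hY.mem ha (by rw [hadef]; field_simp; rfl)
  set Q := (sqDist C₀ α ^ 3).toReal * C₂ with hQ
  have hQ0 : 0 ≤ Q := by positivity
  obtain ⟨C₁₀, hC₁₀, herr⟩ := exists_error_bound hlam ha hδ hC hC₂ hC' hQ0 hs
  have hev : ∀ᶠ t : ℝ in atTop, Real.exp (-t) < ρ₁ :=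
    Real.tendsto_exp_neg_atTop_nhds_zero.eventually_lt_const hρ₁.1
  obtain ⟨t₀, ht₀⟩ := eventually_atTop.1 (hscale.and (herr.and (hev.and
    ((eventually_ge_atTop a⁻¹).and (eventually_ge_atTop δ⁻¹)))))
  -- This threshold on ρ guarantees √|log ρ| ≥ max t₀ 1.
  refine ⟨C₁₀, hC₁₀, Real.exp (-(max t₀ 1) ^ 2), Real.exp_pos _, fun ρ hρ hρ₀ => ?_⟩
  have hlog : Real.log ρ < -(max t₀ 1) ^ 2 := (Real.log_lt_iff_lt_exp hρ).2 hρ₀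
  have hL0 : |Real.log ρ| = -Real.log ρ := abs_of_neg (by nlinarith [sq_nonneg (max t₀ 1)])
  set t := √|Real.log ρ| with ht
  have ht2 : t ^ 2 = |Real.log ρ| := Real.sq_sqrt (abs_nonneg _)
  have htmax : max t₀ 1 ≤ t := Real.le_sqrt_of_sq_le (by rw [hL0]; linarith)
  have ht1 : 1 ≤ t := (le_max_right _ _).trans htmax
  have htpos : 0 < t := by linarith
  have hρt : ρ = Real.exp (-t ^ 2) := by
    rw [ht2, hL0, neg_neg, Real.exp_log hρ]
  obtain ⟨h1, h2, h3, h4, h5⟩ := ht₀ t ((le_max_left _ _).trans htmax)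
  set N := ⌊a * t ^ 2⌋₊ with hN
  set b := ⌊δ * t⌋₊ with hb
  have hN1 : 1 ≤ N := Nat.le_floor (by
    have : 1 ≤ a * t := by rwa [inv_le_iff_one_le_mul₀' ha] at h4
    push_cast; nlinarith)
  have hb1 : 1 ≤ b := Nat.le_floor (by
    rw [inv_le_iff_one_le_mul₀' hδ] at h5; push_cast; exact h5)
  have hsub := veryShortReturns_subset (T := T) hA1 hL (a := a) hρ (N := N)
    (fun n hn => Nat.le_floor (by rw [ht2]; exact hn.le))
  -- The ball bound of (B3) is applied at radius e^(-t), where |log e^(-t)| = t. Hence σ = e^(-t)/3,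
  -- and the exceptional set has mass O(t^(-λ/2)).
  set τ := sqDist C₀ α * ENNReal.ofReal (C₂ * Real.exp (-t) ^ s) with hτ
  have hball : ∀ᵐ x ∂m, ∀ c, c ∉ Ex (Real.exp (-t)) →
      Y.nhat x (Metric.ball c (Real.exp (-t) / 3)) ≤ τ := by
    filter_upwards [hExκ, hY.nhat_ball_le hm (σ := Real.exp (-t) / 3) (by positivity)]
      with x hx hx' c hc
    refine (hx' c).trans (mul_le_mul_right ?_ _)
    rw [mul_div_cancel₀ _ (by norm_num : (3 : ℝ) ≠ 0)]
    exact hx _ ⟨Real.exp_pos _, h3⟩ c hc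
  have hmain := hY.towerMeasure_nearlyPeriodic_le hm hA1 hL (N := N) (b := b)
    (r := 2 * N * A ^ N * ρ) hN1 hball fun q hq => by
      have := h1 N b q rfl rfl hq
      rwa [← hAexp, ← hρt] at this
  refine (measure_mono hsub).trans (hmain.trans ?_)
  have hE : m (Ex (Real.exp (-t))) ≤ ENNReal.ofReal (C₂ * t ^ (-lam / 2)) := by
    refine (hmμ _).trans ((hExμ _ ⟨Real.exp_pos _, h3⟩).trans_eq ?_)
    rw [Real.log_exp, abs_neg, abs_of_pos htpos]
  have hτ' : sqDist C₀ α ^ 2 * τ * m univ ≤ ENNReal.ofReal (Q * Real.exp (-s * t)) := by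
    calc _ ≤ sqDist C₀ α ^ 2 * τ * 1 := by gcongr
      _ = sqDist C₀ α ^ 3 * ENNReal.ofReal (C₂ * Real.exp (-t) ^ s) := by rw [hτ]; ring
      _ = ENNReal.ofReal (Q * Real.exp (-s * t)) := by
          rw [← ENNReal.ofReal_toReal (ENNReal.pow_ne_top (sqDist_ne_top C₀ α) (n := 3)),
            ← ENNReal.ofReal_mul ENNReal.toReal_nonneg, ← Real.exp_mul, hQ]
          congr 1
          rw [mul_assoc]
          congr 3
          ring
  have hfinal : C₁₀ / |Real.log ρ| ^ ((lam - 9) / 4) = C₁₀ * t ^ (-((lam - 9) / 2)) := by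
    rw [← ht2, ← Real.rpow_natCast, ← Real.rpow_mul htpos.le, Real.rpow_neg htpos.le,
      div_eq_mul_inv]
    congr 3
    push_cast
    ring
  rw [hfinal]
  refine le_trans ?_ (ENNReal.ofReal_le_ofReal (h2 N b rfl rfl))
  have hbn : (b : ℝ≥0∞) = ENNReal.ofReal b := (ENNReal.ofReal_natCast b).symm
  have hNn : (N : ℝ≥0∞) + 1 = ENNReal.ofReal (N + 1) := by
    rw [ENNReal.ofReal_add (by positivity) one_pos.le, ENNReal.ofReal_natCast, ENNReal.ofReal_one]
  have hQe : 0 ≤ Q * Real.exp (-s * t) := by positivity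
  rw [ENNReal.ofReal_add (by positivity) (by positivity), ENNReal.ofReal_mul (by positivity),
    ENNReal.ofReal_add (by positivity) (by positivity),
    ENNReal.ofReal_add (by positivity) (by positivity), ENNReal.ofReal_mul (by positivity),
    ENNReal.ofReal_mul (p := (N : ℝ) + 1) (by positivity),
    ENNReal.ofReal_mul (p := (N : ℝ) + 1) (by positivity),
    ENNReal.ofReal_mul (p := (N : ℝ) + 1) (by positivity), ← hbn, ← hNn]
  gcongr
  · exact htail b hb1
  · exact hhigh b hb1

end YoungTower

theorem mainTheorem4
    {E : Type*} [NormedAddCommGroup E] [NormedSpace ℝ E] [FiniteDimensional ℝ E]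
    {M : Type*} [MetricSpace M] [CompactSpace M] [MeasurableSpace M] [BorelSpace M]
    [ChartedSpace E M] [IsManifold 𝓘(ℝ, E) ∞ M]
    [RiemannianBundle (fun x : M => TangentSpace 𝓘(ℝ, E) x)]
    [IsContinuousRiemannianBundle E (fun x : M => TangentSpace 𝓘(ℝ, E) x)]
    [IsRiemannianManifold 𝓘(ℝ, E) M]
    (T : M ≃ₘ^2⟮𝓘(ℝ, E), 𝓘(ℝ, E)⟯ M)
    {ι : Type*} [Countable ι] (Y : YoungTower (T : M → M) ι)
    (m : Measure M) (κ : Kernel M M) (hm : Y.IsSRB m κ)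
    (hμ : IsProbabilityMeasure (Y.towerMeasure m))
    (lam : ℝ) (hlam : 9 < lam)
    (hB1 : Y.Regular)
    (hB2 : Y.PolynomialTail lam)
    (hB3 : GeometricallyRegular m κ (Y.towerMeasure m) lam) :
    ∃ C₁₀ : ℝ, 0 < C₁₀ ∧ ∃ ρ₀ : ℝ, 0 < ρ₀ ∧ ∀ ρ : ℝ, 0 < ρ → ρ < ρ₀ →
      Y.towerMeasure m (veryShortReturns T (shortReturnConst T) ρ) ≤
        ENNReal.ofReal (C₁₀ / |Real.log ρ| ^ ((lam - 9) / 4)) := by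
  have hT : ContMDiff 𝓘(ℝ, E) 𝓘(ℝ, E) 1 T := T.contMDiff.of_le (by norm_num)
  have : IsManifold 𝓘(ℝ, E) 1 M := IsManifold.of_le (n := ∞) (by simp)
  have h0 : ∀ f : M → M, 0 ≤ supNormDeriv E f := fun f =>
    Real.iSup_nonneg fun x => ContinuousLinearMap.opNorm_nonneg _
  refine YoungTower.measure_veryShortReturns_le
    T.toHomeomorph.measurableEmbedding (add_nonneg (h0 T) (h0 T.symm)) (fun x y => ?_) Y hm hμ hlam
    hB1 hB2 hB3
  -- A dominates the Lipschitz constant ‖DT‖ of T, because the term of the inverse is non-negative.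
  exact (dist_le_supNormDeriv_mul_dist hT x y).trans
    (mul_le_mul_of_nonneg_right (le_add_of_nonneg_right (h0 _)) dist_nonneg)
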